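/- Let $\mathcal A$ be a finite alphabet. A random substitution is a map $\vartheta$ assigning to each letter $a\in\mathcal A$ a non-empty finite set $\vartheta(a)$ of non-empty words over $\mathcal A$; it extends to words by $\vartheta(a_1\cdots a_n)=\vartheta(a_1)\cdots\vartheta(a_n)$ (concatenation of sets), to sets of words by $\vartheta(U)=\bigcup_{u\in U}\vartheta(u)$, and its powers are $\vartheta^0(a)=\{a\}$, $\vartheta^{p+1}(a)=\vartheta(\vartheta^p(a))$. A non-empty word is legal if it is a subword of a word in $\vartheta^p(a)$ for some $a\in\mathcal A$ and $p\ge 0$. Let $X_\vartheta\subseteq\mathcal A^{\mathbb Z}$ be the set of bi-infinite sequences all of whose finite non-empty subwords are legal, with the subspace topology of the product topology and the shift $\sigma(x)_i=x_{i+1}$, and let $\operatorname{Aut}(X_\vartheta)$ be the group of homeomorphisms $X_\vartheta\to X_\vartheta$ commuting with $\sigma$. We call $\vartheta$ non-degenerate if $\#\vartheta(a)\neq 1$ for some $a$; constant-length if there is $L$ with $|u|=L$ for all $a\in\mathcal A$ and $u\in\vartheta(a)$; primitive if there is $p\ge1$ such that for all $a,b\in\mathcal A$ the letter $a$ occurs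 in some word of $\vartheta^p(b)$; compatible if for every $a$, any two words of $\vartheta(a)$ contain each letter equally often; and we say that $\vartheta$ has disjoint images of letters if $\vartheta(a)\cap\vartheta(b)\neq\varnothing$ implies $a=b$. An inflation word decomposition of a legal word $u$ is a pair $([u_1,\dots,u_\ell],v_1\cdots v_\ell)$ with $u_1,\dots,u_\ell$ non-empty words, $u=u_1\cdots u_\ell$, $v_1\cdots v_\ell$ a legal word, $u_k\in\vartheta(v_k)$ for $1<k<\ell$, $u_1$ a suffix of a word in $\vartheta(v_1)$ and $u_\ell$ a prefix of a word in $\vartheta(v_\ell)$ (if $\ell=1$: $u$ is a subword of a word in $\vartheta(v_1)$). It induces an inflation word decomposition on each non-empty subword of $u$ at a given position, by restricting the pieces to that subword and discarding the pieces, with their letters $v_k$, that do not meet it. A legal word $u$ is recognisable if there is $N\ge0$ such that, for every legal word $w=u^{(l)}uu^{(r)}$ with $|u^{(l)}|=|u^{(r)}|=N$, all inflation word decompositions of $w$ induce the same inflation word decomposition of the indicated occurrence of $u$. Theorem. Let $\vartheta$ be a non-degenerate, constant-length, primitive, compatible random substitution with disjoint images of letters for which at least one legal word is recognisable. Let $G=\bigoplus_{i\in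 I}G_i$ be a direct sum of finite groups over a countable index set $I$ (the group of families $(g_i)$ with $g_i=1$ for all but finitely many $i$). Then there is an injective group homomorphism $G\to\operatorname{Aut}(X_\vartheta)$. -/

import Mathlib

/-- A random substitution on the alphabet `A`: every letter is sent to a nonempty finite set of
nonempty words over `A`. -/
structure RandomSubstitution (A : Type*) where
  /-- the set `ϑ(a)` of inflation words of type `a` -/
  image : A → Finset (List A)
  image_nonempty : ∀ a, (image a).Nonempty
  nil_notMem_image : ∀ a, [] ∉ image a

namespace RandomSubstitution

variable {A : Type*} (ϑ : RandomSubstitution A)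

/-- `ϑ(v₁ ⋯ vₙ) = ϑ(v₁) ⋯ ϑ(vₙ)`, the set of realisations of `ϑ` on a word. -/
def imageWord : List A → Set (List A)
  | [] => {[]}
  | a :: v => {w | ∃ s ∈ ϑ.image a, ∃ t ∈ imageWord v, w = s ++ t}

/-- `ϑ(U)`, the set of all realisations of `ϑ` on words of `U`. -/
def imageSet (U : Set (List A)) : Set (List A) :=
  {w | ∃ u ∈ U, w ∈ ϑ.imageWord u}

/-- `ϑ^p(a)`, the set of level-`p` inflation words of type `a`. -/
def power : ℕ → A → Set (List A)
  | 0, a => {[a]}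
  | p + 1, a => ϑ.imageSet (power p a)

/-- A nonempty word is legal if it is a subword of some level-`p` inflation word, `p ≥ 0`. -/
def Legal (u : List A) : Prop :=
  u ≠ [] ∧ ∃ (a : A) (p : ℕ), ∃ w ∈ ϑ.power p a, u <:+: w

/-- All realisations on a given letter have the same abelianisation. -/
def Compatible [DecidableEq A] : Prop :=
  ∀ a, ∀ u ∈ ϑ.image a, ∀ v ∈ ϑ.image a, ∀ b, u.count b = v.count b

/-- For some `p ≥ 1` and all letters `a`, `b`, the letter `a` occurs in some word of `ϑ^p(b)`. -/
def Primitive : Prop :=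
  ∃ p : ℕ, 1 ≤ p ∧ ∀ a b : A, ∃ w ∈ ϑ.power p b, a ∈ w

def ConstantLength : Prop :=
  ∃ L : ℕ, ∀ a, ∀ u ∈ ϑ.image a, u.length = L

def Degenerate : Prop :=
  ∀ a, (ϑ.image a).card = 1

def DisjointImagesOfLetters : Prop :=
  ∀ a b : A, (∃ w, w ∈ ϑ.image a ∧ w ∈ ϑ.image b) → a = b

/-! ### Inflation word decompositions and recognisable words -/

/-- `d = [(u₁, v₁), …, (u_ℓ, v_ℓ)]` encodes the inflation word decomposition
`([u₁, …, u_ℓ], v₁ ⋯ v_ℓ)` of `u`: the pieces `u_k` are nonempty with concatenation `u`, the root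
`v₁ ⋯ v_ℓ` is legal, interior pieces satisfy `u_k ∈ ϑ(v_k)`, the first piece is a suffix of a word
of `ϑ(v₁)` and the last one a prefix of a word of `ϑ(v_ℓ)`. If `ℓ = 1`, then `u` is a subword of a
word of `ϑ(v₁)`. -/
def IsDecomposition (u : List A) (d : List (List A × A)) : Prop :=
  (d.map Prod.fst).flatten = u ∧
  (∀ q ∈ d, q.1 ≠ []) ∧
  ϑ.Legal (d.map Prod.snd) ∧
  ∀ (k : ℕ) (hk : k < d.length), ∃ s t : List A,
    s ++ (d[k]).1 ++ t ∈ ϑ.image (d[k]).2 ∧ (0 < k → s = []) ∧ (k + 1 < d.length → t = [])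

/-- Delete the first `i` letters of the decomposed word. -/
def dropLetters : ℕ → List (List A × A) → List (List A × A)
  | _, [] => []
  | i, (p, a) :: d =>
    if i < p.length then (p.drop i, a) :: d else dropLetters (i - p.length) d

/-- Keep only the first `n` letters of the decomposed word (for `n ≥ 1`). -/
def takeLetters : ℕ → List (List A × A) → List (List A × A)
  | _, [] => []
  | n, (p, a) :: d =>
    if n ≤ p.length then [(p.take n, a)] else (p, a) :: takeLetters (n - p.length) d

/-- The inflation word decomposition induced by `d` on the subword of length `n ≥ 1` that starts
after the first `i` letters. -/
def induced (d : List (List A × A)) (i n : ℕ) : List (List A × A) :=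
  takeLetters n (dropLetters i d)

/-- A legal word `u` is recognisable if, for some `N`, the `N` letters to the left and the `N`
letters to the right of `u` determine the induced inflation word decomposition of `u`. -/
def Recognisable (u : List A) : Prop :=
  ϑ.Legal u ∧ ∃ N : ℕ, ∀ l r : List A, l.length = N → r.length = N → ϑ.Legal (l ++ u ++ r) →
    ∀ d d' : List (List A × A),
      ϑ.IsDecomposition (l ++ u ++ r) d → ϑ.IsDecomposition (l ++ u ++ r) d' →
      induced d N u.length = induced d' N u.length

def AdmitsRecognisableWord : Prop :=
  ∃ u : List A, ϑ.Recognisable u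

/-! ### The subshift and its automorphism group -/

/-- The subword `x_i ⋯ x_{i+n-1}` of a bi-infinite sequence. -/
def subword (x : ℤ → A) (i : ℤ) (n : ℕ) : List A :=
  List.ofFn fun k : Fin n => x (i + (k : ℤ))

/-- The bi-infinite sequences all of whose (nonempty, finite) subwords are legal. -/
def subshift : Set (ℤ → A) :=
  {x | ∀ (i : ℤ) (n : ℕ), 1 ≤ n → ϑ.Legal (subword x i n)}

theorem translate_mem_subshift {x : ℤ → A} (hx : x ∈ ϑ.subshift) (m : ℤ) :
    (fun i => x (i + m)) ∈ ϑ.subshift := by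
  intro i n hn
  have h := hx (i + m) n hn
  have e : subword (fun i => x (i + m)) i n = subword x (i + m) n := by
    simp only [subword, add_right_comm]
  rw [e]
  exact h

variable [TopologicalSpace A]

/-- The shift `σ(x)_i = x_{i+1}` as a homeomorphism of the subshift. -/
def shift : ϑ.subshift ≃ₜ ϑ.subshift where
  toFun x := ⟨fun i => x.1 (i + 1), ϑ.translate_mem_subshift x.2 1⟩
  invFun x := ⟨fun i => x.1 (i + -1), ϑ.translate_mem_subshift x.2 (-1)⟩
  left_inv x := by ext i; simp
  right_inv x := by ext i; simp
  continuous_toFun := by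
    refine Continuous.subtype_mk (continuous_pi fun i => ?_) _
    exact (continuous_apply (i + 1)).comp continuous_subtype_val
  continuous_invFun := by
    refine Continuous.subtype_mk (continuous_pi fun i => ?_) _
    exact (continuous_apply (i + -1)).comp continuous_subtype_val

/-- `Aut(X_ϑ)`: the homeomorphisms of the subshift that commute with the shift. -/
abbrev Aut : Subgroup (ϑ.subshift ≃ₜ ϑ.subshift) :=
  Subgroup.centralizer {ϑ.shift}

end RandomSubstitution

/-- The direct sum of a family of (not necessarily commutative) groups: the families `(g i)` with
`g i = 1` for all but finitely many `i`, with componentwise multiplication. -/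
abbrev GroupDirectSum {ι : Type*} (G : ι → Type*) [∀ i, Group (G i)] : Type _ :=
  RestrictedProduct G (fun i => ((⊥ : Subgroup (G i)) : Set (G i))) Filter.cofinite

/-! The automorphisms are of marker type. Fix a realisation `marker` of a legal word and, for each
`i`, words of one common length labelled by the elements of `G i`. An element `g` acts on a point by
replacing every labelled word that stands between two consecutive markers by the word with label
multiplied on the left by `g i`. If the marker overlaps `marker ++ word ++ marker` only at its ends,
these replacements neither create nor destroy markers or patterns, so they compose like the group.
Finite support bounds the length of the words that move, hence `exchange g` is a sliding block code;
its faithfulness is seen at a single pattern.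

The replacements must stay inside the subshift. They do if all words of index `i` realise the same
legal root and the marker is synchronising: each of its occurrences in a realisation of a legal word
starts at a multiple of `L`. The exchanged words are then unions of inflation words, disjoint images
identify the letters they come from, and the exchange only alters the realisation of a fixed root
(`Realises.exchange_mem_subshift`).

A synchronising word is extracted from the recognisable one in `exists_synchronising`. Without such
a word, all realisations could be displaced by some proper divisor `j` of `L`. Recognisability then
lets an inflation word `w` containing the recognisable word be pushed to the right repeatedly by
`j`, leaving behind powers of its prefix `w₁` of length `j`. A long aligned power of `w₁` is a
repetition of one inflation word `B`. Its root is long enough to contain every letter, so `B`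
belongs to every `ϑ(a)`, against disjointness of images.

Labels come from a letter `e` with two images `β ≠ β'` (`exists_realises`). Among the occurrences of
`e` in a long root, exactly one is realised by `β` and its position encodes the group element. The
many `β'` elsewhere keep the marker, which has a long stretch without `β'`, from occurring inside.
-/

namespace RandomSubstitution

/-! ### Realisations of words, iterates and legality -/

section Words

variable {A : Type*} {ϑ : RandomSubstitution A} {L : ℕ}

@[simp] theorem mem_imageWord_nil {w : List A} : w ∈ ϑ.imageWord [] ↔ w = [] := Iff.rfl

theorem mem_imageWord_cons {a : A} {v w : List A} :
    w ∈ ϑ.imageWord (a :: v) ↔ ∃ s ∈ ϑ.image a, ∃ t ∈ ϑ.imageWord v, w = s ++ t := Iff.rfl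

theorem mem_imageWord_singleton {a : A} {w : List A} :
    w ∈ ϑ.imageWord [a] ↔ w ∈ ϑ.image a := by
  simp [mem_imageWord_cons]

theorem mem_imageWord_append {u v w : List A} :
    w ∈ ϑ.imageWord (u ++ v) ↔ ∃ s ∈ ϑ.imageWord u, ∃ t ∈ ϑ.imageWord v, w = s ++ t := by
  induction u generalizing w with
  | nil => simp
  | cons a u ih =>
    simp only [List.cons_append, mem_imageWord_cons, ih]
    constructor
    · rintro ⟨s, hs, _, ⟨t, ht, r, hr, rfl⟩, rfl⟩
      exact ⟨s ++ t, ⟨s, hs, t, ht, rfl⟩, r, hr, by simp⟩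
    · rintro ⟨_, ⟨s, hs, t, ht, rfl⟩, r, hr, rfl⟩
      exact ⟨s, hs, t ++ r, ⟨t, ht, r, hr, rfl⟩, by simp⟩

theorem append_mem_imageWord {u v s t : List A} (hs : s ∈ ϑ.imageWord u)
    (ht : t ∈ ϑ.imageWord v) : s ++ t ∈ ϑ.imageWord (u ++ v) :=
  mem_imageWord_append.2 ⟨s, hs, t, ht, rfl⟩

theorem imageWord_nonempty (v : List A) : (ϑ.imageWord v).Nonempty := by
  induction v with
  | nil => exact ⟨[], rfl⟩
  | cons a v ih =>
    obtain ⟨t, ht⟩ := ih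
    obtain ⟨s, hs⟩ := ϑ.image_nonempty a
    exact ⟨s ++ t, s, hs, t, ht, rfl⟩

theorem length_of_mem_imageWord (hL : ∀ a, ∀ u ∈ ϑ.image a, u.length = L) {v w : List A}
    (hw : w ∈ ϑ.imageWord v) : w.length = L * v.length := by
  induction v generalizing w with
  | nil => simp_all
  | cons a v ih =>
    obtain ⟨s, hs, t, ht, rfl⟩ := hw
    simp [ih ht, hL a s hs]; ring

/-- A realisation is cut along inflation words whenever it is cut at a multiple of `L`. -/
theorem mem_imageWord_split (hL : ∀ a, ∀ u ∈ ϑ.image a, u.length = L) {p q z : List A} {k : ℕ}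
    (h : p ++ q ∈ ϑ.imageWord z) (hp : p.length = L * k) (hk : k ≤ z.length) :
    p ∈ ϑ.imageWord (z.take k) ∧ q ∈ ϑ.imageWord (z.drop k) := by
  rw [← List.take_append_drop k z] at h
  obtain ⟨s, hs, t, ht, e⟩ := mem_imageWord_append.1 h
  have hl : p.length = s.length := by
    rw [length_of_mem_imageWord hL hs, hp, List.length_take, min_eq_left hk]
  obtain ⟨rfl, rfl⟩ := List.append_inj e hl
  exact ⟨hs, ht⟩

/-- The set of level-`p` realisations of a word. -/
def iterWord (ϑ : RandomSubstitution A) : ℕ → List A → Set (List A)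
  | 0, v => {v}
  | p + 1, v => ϑ.imageSet (iterWord ϑ p v)

theorem power_eq_iterWord (p : ℕ) (a : A) : ϑ.power p a = ϑ.iterWord p [a] := by
  induction p with
  | zero => rfl
  | succ p ih => simp only [power, iterWord, ih]

theorem mem_iterWord_succ {p : ℕ} {v w : List A} :
    w ∈ ϑ.iterWord (p + 1) v ↔ ∃ u ∈ ϑ.iterWord p v, w ∈ ϑ.imageWord u := Iff.rfl

theorem mem_iterWord_add {p q : ℕ} {v w : List A} :
    w ∈ ϑ.iterWord (p + q) v ↔ ∃ u ∈ ϑ.iterWord p v, w ∈ ϑ.iterWord q u := by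
  induction q generalizing w with
  | zero => simp [iterWord]
  | succ q ih =>
    rw [← add_assoc]
    simp only [mem_iterWord_succ, ih]
    constructor
    · rintro ⟨u, ⟨t, ht, hu⟩, hw⟩; exact ⟨t, ht, u, hu, hw⟩
    · rintro ⟨t, ht, u, hu, hw⟩; exact ⟨u, ⟨t, ht, hu⟩, hw⟩

theorem mem_iterWord_append {p : ℕ} {u v w : List A} :
    w ∈ ϑ.iterWord p (u ++ v) ↔ ∃ s ∈ ϑ.iterWord p u, ∃ t ∈ ϑ.iterWord p v, w = s ++ t := by
  induction p generalizing w with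
  | zero => simp [iterWord]
  | succ p ih =>
    simp only [mem_iterWord_succ, ih]
    constructor
    · rintro ⟨_, ⟨s, hs, t, ht, rfl⟩, hw⟩
      obtain ⟨s', hs', t', ht', rfl⟩ := mem_imageWord_append.1 hw
      exact ⟨s', ⟨s, hs, hs'⟩, t', ⟨t, ht, ht'⟩, rfl⟩
    · rintro ⟨s', ⟨s, hs, hs'⟩, t', ⟨t, ht, ht'⟩, rfl⟩
      exact ⟨_, ⟨s, hs, t, ht, rfl⟩, append_mem_imageWord hs' ht'⟩

theorem iterWord_nonempty (p : ℕ) (v : List A) : (ϑ.iterWord p v).Nonempty := by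
  induction p with
  | zero => exact ⟨v, rfl⟩
  | succ p ih =>
    obtain ⟨u, hu⟩ := ih
    obtain ⟨w, hw⟩ := ϑ.imageWord_nonempty u
    exact ⟨w, u, hu, hw⟩

theorem length_of_mem_iterWord (hL : ∀ a, ∀ u ∈ ϑ.image a, u.length = L) {p : ℕ} {v w : List A}
    (hw : w ∈ ϑ.iterWord p v) : w.length = L ^ p * v.length := by
  induction p generalizing w with
  | zero => obtain rfl : w = v := hw; simp
  | succ p ih =>
    obtain ⟨u, hu, hw⟩ := hw
    rw [length_of_mem_imageWord hL hw, ih hu, pow_succ]; ring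

theorem exists_infix_mem_iterWord {p : ℕ} {u v w : List A} (h : u <:+: v)
    (hw : w ∈ ϑ.iterWord p u) : ∃ w' ∈ ϑ.iterWord p v, w <:+: w' := by
  obtain ⟨s, t, rfl⟩ := h
  obtain ⟨s', hs⟩ := ϑ.iterWord_nonempty p s
  obtain ⟨t', ht⟩ := ϑ.iterWord_nonempty p t
  exact ⟨s' ++ w ++ t',
    mem_iterWord_append.2 ⟨_, mem_iterWord_append.2 ⟨_, hs, _, hw, rfl⟩, _, ht, rfl⟩, s', t', rfl⟩

theorem legal_iff {u : List A} :
    ϑ.Legal u ↔ u ≠ [] ∧ ∃ (a : A) (p : ℕ), ∃ w ∈ ϑ.iterWord p [a], u <:+: w := by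
  simp only [Legal, power_eq_iterWord]

theorem Legal.infix {u v : List A} (h : ϑ.Legal v) (huv : u <:+: v) (hu : u ≠ []) :
    ϑ.Legal u := by
  obtain ⟨_, a, p, w, hw, hv⟩ := h
  exact ⟨hu, a, p, w, hw, huv.trans hv⟩

theorem legal_singleton (a : A) : ϑ.Legal [a] :=
  ⟨by simp, a, 0, [a], rfl, List.infix_rfl⟩

theorem Legal.iterWord {p : ℕ} {v w : List A} (h : ϑ.Legal v) (hw : w ∈ ϑ.iterWord p v)
    (hne : w ≠ []) : ϑ.Legal w := by
  obtain ⟨_, a, q, v', hv', hv⟩ := legal_iff.1 h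
  obtain ⟨w', hw', h'⟩ := exists_infix_mem_iterWord hv hw
  exact legal_iff.2 ⟨hne, a, q + p, w', mem_iterWord_add.2 ⟨v', hv', hw'⟩, h'⟩

theorem mem_iterWord_one {v w : List A} : w ∈ ϑ.iterWord 1 v ↔ w ∈ ϑ.imageWord v := by
  refine mem_iterWord_succ.trans ⟨?_, fun h => ⟨v, rfl, h⟩⟩
  rintro ⟨u, rfl, hw⟩
  exact hw

theorem Legal.imageWord {v w : List A} (h : ϑ.Legal v) (hw : w ∈ ϑ.imageWord v)
    (hne : w ≠ []) : ϑ.Legal w :=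
  h.iterWord (mem_iterWord_one.2 hw) hne

/-- A legal word of length at least two is a subword of a realisation of a legal word. -/
theorem Legal.exists_root_of_two_le {w : List A} (h : ϑ.Legal w) (hw : 2 ≤ w.length) :
    ∃ z, ϑ.Legal z ∧ ∃ V ∈ ϑ.imageWord z, w <:+: V := by
  obtain ⟨_, a, p, V, hV, hwV⟩ := legal_iff.1 h
  obtain _ | p := p
  · obtain rfl : V = [a] := hV
    have := hwV.length_le
    simp only [List.length_singleton] at this; omega
  · obtain ⟨z, hz, hV⟩ := hV
    refine ⟨z, legal_iff.2 ⟨?_, a, p, z, hz, List.infix_rfl⟩, V, hV, hwV⟩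
    rintro rfl
    obtain rfl : V = [] := hV
    have := hwV.length_le
    simp only [List.length_nil] at this; omega

end Words

/-! ### Abelianisations under compatibility -/

section Compatible

variable {A : Type*} [DecidableEq A] {ϑ : RandomSubstitution A} {L : ℕ}

theorem Compatible.perm_imageWord (h : ϑ.Compatible) {v v' w w' : List A} (hv : v.Perm v')
    (hw : w ∈ ϑ.imageWord v) (hw' : w' ∈ ϑ.imageWord v') : w.Perm w' := by
  have key : ∀ (v w w' : List A), w ∈ ϑ.imageWord v → w' ∈ ϑ.imageWord v → w.Perm w' := by
    intro v
    induction v with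
    | nil => intro w w' hw hw'; rw [mem_imageWord_nil.1 hw, mem_imageWord_nil.1 hw']
    | cons a v ih =>
      rintro _ _ ⟨s, hs, t, ht, rfl⟩ ⟨s', hs', t', ht', rfl⟩
      exact (List.perm_iff_count.2 (h a s hs s' hs')).append (ih t t' ht ht')
  induction hv generalizing w w' with
  | nil => exact key _ _ _ hw hw'
  | cons a _ ih =>
    obtain ⟨s, hs, t, ht, rfl⟩ := hw
    obtain ⟨s', hs', t', ht', rfl⟩ := hw'
    exact (List.perm_iff_count.2 (h a s hs s' hs')).append (ih ht ht')
  | swap a b l =>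
    obtain ⟨s, hs, _, ⟨t, ht, r, hr, rfl⟩, rfl⟩ := hw
    -- Interchanging the two leading image blocks realises the interchanged root, which reduces the
    -- case to a common root.
    have hm : t ++ (s ++ r) ∈ ϑ.imageWord (a :: b :: l) := ⟨t, ht, _, ⟨s, hs, r, hr, rfl⟩, rfl⟩
    refine List.Perm.trans ?_ (key _ _ _ hm hw')
    rw [← List.append_assoc, ← List.append_assoc]
    exact List.perm_append_comm.append_right r
  | trans h₁ h₂ ih₁ ih₂ =>
    obtain ⟨m, hm⟩ := ϑ.imageWord_nonempty _
    exact (ih₁ hw hm).trans (ih₂ hm hw')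

theorem Compatible.perm_iterWord (h : ϑ.Compatible) {p : ℕ} {v w w' : List A}
    (hw : w ∈ ϑ.iterWord p v) (hw' : w' ∈ ϑ.iterWord p v) : w.Perm w' := by
  induction p generalizing w w' with
  | zero => rw [show w = v from hw, show w' = v from hw']
  | succ p ih =>
    obtain ⟨u, hu, hw⟩ := hw
    obtain ⟨u', hu', hw'⟩ := hw'
    exact h.perm_imageWord (ih hu hu') hw hw'

end Compatible

/-! ### Consequences of primitivity: joining, recurrence and extension of legal words -/

section Primitive

variable {A : Type*} {ϑ : RandomSubstitution A} {L : ℕ}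

theorem Primitive.exists_forall_ge (h : ϑ.Primitive) (hL : ∀ a, ∀ u ∈ ϑ.image a, u.length = L)
    (hL0 : 0 < L) :
    ∃ P : ℕ, ∀ n, P ≤ n → ∀ a b : A, ∃ w ∈ ϑ.iterWord n [b], a ∈ w := by
  obtain ⟨P, _, hP⟩ := h
  simp only [power_eq_iterWord] at hP
  refine ⟨P, fun n hn a b => ?_⟩
  obtain ⟨v, hv⟩ := ϑ.iterWord_nonempty (n - P) [b]
  have hv0 : v ≠ [] := by
    rintro rfl
    have := length_of_mem_iterWord hL hv
    have := Nat.pow_pos (n := n - P) hL0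
    simp_all
  obtain ⟨c, v, rfl⟩ := List.exists_cons_of_ne_nil hv0
  obtain ⟨w, hw, haw⟩ := hP a c
  obtain ⟨w', hw', h⟩ := exists_infix_mem_iterWord (v := c :: v) ⟨[], v, rfl⟩ hw
  refine ⟨w', ?_, h.subset haw⟩
  have := mem_iterWord_add.2 ⟨_, hv, hw'⟩
  rwa [Nat.sub_add_cancel hn] at this

theorem Legal.exists_forall_ge (h : ϑ.Primitive) (hL : ∀ a, ∀ u ∈ ϑ.image a, u.length = L)
    (hL0 : 0 < L) {y : List A} (hy : ϑ.Legal y) :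
    ∃ P : ℕ, ∀ n, P ≤ n → ∀ b : A, ∃ w ∈ ϑ.iterWord n [b], y <:+: w := by
  obtain ⟨P, hP⟩ := h.exists_forall_ge hL hL0
  obtain ⟨_, a, q, Y, hY, hyY⟩ := legal_iff.1 hy
  refine ⟨P + q, fun n hn b => ?_⟩
  obtain ⟨v, hv, hav⟩ := hP (n - q) (by omega) a b
  obtain ⟨s, t, rfl⟩ := List.append_of_mem hav
  obtain ⟨w, hw, h⟩ := exists_infix_mem_iterWord (v := s ++ a :: t) ⟨s, t, by simp⟩ hY
  refine ⟨w, ?_, hyY.trans h⟩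
  have := mem_iterWord_add.2 ⟨_, hv, hw⟩
  rwa [Nat.sub_add_cancel (by omega)] at this

/-- Any two legal words occur, in this order, in a common legal word. -/
theorem Legal.exists_append (h : ϑ.Primitive) (hL : ∀ a, ∀ u ∈ ϑ.image a, u.length = L)
    (hL2 : 2 ≤ L) {y z : List A} (hy : ϑ.Legal y) (hz : ϑ.Legal z) :
    ∃ m, ϑ.Legal (y ++ m ++ z) := by
  obtain ⟨P, hP⟩ := hy.exists_forall_ge h hL (by omega)
  obtain ⟨Q, hQ⟩ := hz.exists_forall_ge h hL (by omega)
  obtain ⟨_, a, _⟩ := hy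
  obtain ⟨v, hv⟩ := ϑ.image_nonempty a
  have hvl := hL a v hv
  match v, hvl with
  | [], hvl => simp at hvl; omega
  | [_], hvl => simp at hvl; omega
  -- An image has at least two letters because `2 ≤ L`; one common iterate then puts `y` into the
  -- image of `c` and `z` into that of the next letter `d`.
  | c :: d :: v, _ =>
    obtain ⟨Y, hY, s, t, rfl⟩ := hP (P + Q) (by omega) c
    obtain ⟨Z, hZ, s', t', rfl⟩ := hQ (P + Q) (by omega) d
    obtain ⟨r, hr⟩ := ϑ.iterWord_nonempty (P + Q) v
    have h1 : ϑ.Legal (c :: d :: v) :=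
      (legal_singleton a).imageWord (mem_imageWord_singleton.2 hv) (by simp)
    have h2 : (s ++ y ++ t) ++ ((s' ++ z ++ t') ++ r) ∈ ϑ.iterWord (P + Q) (c :: d :: v) :=
      mem_iterWord_append (u := [c]).2
        ⟨_, hY, _, mem_iterWord_append (u := [d]).2 ⟨_, hZ, _, hr, rfl⟩, rfl⟩
    have hne : y ≠ [] := by assumption
    refine ⟨t ++ s', (h1.iterWord h2 (by simp [hne])).infix ⟨s, t' ++ r, by simp⟩ (by simp [hne])⟩

/-- Every letter occurs in all sufficiently long legal words. -/
theorem exists_length_forall_mem [DecidableEq A] (h : ϑ.Primitive) (hc : ϑ.Compatible)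
    (hL : ∀ a, ∀ u ∈ ϑ.image a, u.length = L) (hL2 : 2 ≤ L) :
    ∃ R, ∀ w, ϑ.Legal w → R ≤ w.length → ∀ a, a ∈ w := by
  obtain ⟨P, hP⟩ := h.exists_forall_ge hL (by omega)
  have hLP : 0 < L ^ P := Nat.pow_pos (by omega)
  -- A window of twice the length of a level-`P` inflation word contains a complete one.
  refine ⟨2 * L ^ P, fun w hw hwl a => ?_⟩
  obtain ⟨_, b, p, V, hV, s, t, rfl⟩ := legal_iff.1 hw
  clear hw
  have hpP : P ≤ p := by
    by_contra hlt
    have h1 := length_of_mem_iterWord hL hV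
    have h2 := Nat.pow_le_pow_right (n := L) (by omega) (not_le.1 hlt).le
    simp only [List.length_append, List.length_singleton, mul_one] at h1; omega
  rw [← Nat.sub_add_cancel hpP] at hV
  obtain ⟨z, -, hz⟩ := mem_iterWord_add.1 hV
  clear hV
  induction z generalizing s with
  | nil =>
    have := length_of_mem_iterWord hL hz
    simp only [List.length_append, List.length_nil, mul_zero] at this; omega
  | cons c z ih =>
    obtain ⟨B, hB, V', hV', e⟩ := mem_iterWord_append (u := [c]).1 hz
    have hBl : B.length = L ^ P := by simpa using length_of_mem_iterWord hL hB
    by_cases hs : L ^ P ≤ s.length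
    · have : s = B ++ s.drop (L ^ P) := by
        have h1 := congrArg (List.take (L ^ P)) e
        rw [List.append_assoc, List.take_append_of_le_length hs,
          List.take_append_of_le_length hBl.ge, List.take_of_length_le hBl.le] at h1
        rw [← h1, List.take_append_drop]
      rw [this, List.append_assoc, List.append_assoc] at e
      refine ih (s.drop (L ^ P)) ?_
      rw [List.append_assoc, List.append_cancel_left e]
      exact hV'
    · obtain _ | ⟨d, z⟩ := z
      · have h1 := length_of_mem_iterWord hL hV'
        have h2 := congrArg List.length e
        simp only [List.length_append, List.length_nil, mul_zero] at h1 h2; omega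
      obtain ⟨C, hC, V'', hV'', rfl⟩ := mem_iterWord_append (u := [d]).1 hV'
      have hCl : C.length = L ^ P := by simpa using length_of_mem_iterWord hL hC
      obtain ⟨C', hC', haC'⟩ := hP P le_rfl a d
      have haC : a ∈ C := (hc.perm_iterWord hC hC').mem_iff.2 haC'
      obtain ⟨i, hi, rfl⟩ := List.getElem_of_mem haC
      have h3 : (s ++ w ++ t)[L ^ P + i]? = some C[i] := by
        rw [e, List.getElem?_append_right (by omega), hBl, Nat.add_sub_cancel_left,
          List.getElem?_append_left hi, List.getElem?_eq_getElem hi]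
      rw [List.append_assoc, List.getElem?_append_right (by omega),
        List.getElem?_append_left (by omega)] at h3
      exact List.mem_of_getElem? h3

theorem Legal.exists_extend_length (h : ϑ.Primitive) (hL : ∀ a, ∀ u ∈ ϑ.image a, u.length = L)
    (hL2 : 2 ≤ L) {y : List A} (hy : ϑ.Legal y) (n : ℕ) :
    ∃ p q : List A, n ≤ p.length ∧ n ≤ q.length ∧ ϑ.Legal (p ++ y ++ q) := by
  induction n with
  | zero => exact ⟨[], [], by simp, by simp, by simpa using hy⟩
  | succ n ih =>
    obtain ⟨p, q, hp, hq, hpq⟩ := ih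
    obtain ⟨m, hm⟩ := hpq.exists_append h hL hL2 hy
    obtain ⟨m', hm'⟩ := hy.exists_append h hL hL2 hm
    have : 1 ≤ y.length := List.length_pos_of_ne_nil hy.1
    refine ⟨y ++ m' ++ p, q ++ m ++ y, ?_, ?_, by simpa using hm'⟩ <;> simp <;> omega

theorem Legal.exists_extend (h : ϑ.Primitive) (hL : ∀ a, ∀ u ∈ ϑ.image a, u.length = L)
    (hL2 : 2 ≤ L) {y : List A} (hy : ϑ.Legal y) (n : ℕ) :
    ∃ p q : List A, p.length = n ∧ q.length = n ∧ ϑ.Legal (p ++ y ++ q) := by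
  obtain ⟨p, q, hp, hq, hpq⟩ := hy.exists_extend_length h hL hL2 n
  refine ⟨p.drop (p.length - n), q.take n, by simp; omega, by simp; omega, hpq.infix
    ⟨p.take (p.length - n), q.drop n, ?_⟩ (by simp [hy.1])⟩
  rw [List.append_assoc, List.append_assoc, List.append_assoc, List.take_append_drop,
    ← List.append_assoc, ← List.append_assoc, List.take_append_drop, List.append_assoc]

theorem Legal.exists_root (h : ϑ.Primitive) (hL : ∀ a, ∀ u ∈ ϑ.image a, u.length = L)
    (hL2 : 2 ≤ L) {w : List A} (hw : ϑ.Legal w) :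
    ∃ z, ϑ.Legal z ∧ ∃ V ∈ ϑ.imageWord z, w <:+: V := by
  obtain ⟨p, q, hp, hq, hpq⟩ := hw.exists_extend h hL hL2 1
  obtain ⟨z, hz, V, hV, hi⟩ := hpq.exists_root_of_two_le (by simp; omega)
  exact ⟨z, hz, V, hV, List.IsInfix.trans ⟨p, q, rfl⟩ hi⟩

end Primitive

/-! ### Consequences of non-degeneracy -/

section Degenerate

variable {A : Type*} {ϑ : RandomSubstitution A} {L : ℕ}

theorem exists_two_images (hnd : ¬ ϑ.Degenerate) :
    ∃ e, ∃ β ∈ ϑ.image e, ∃ β' ∈ ϑ.image e, β ≠ β' := by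
  simp only [Degenerate, not_forall] at hnd
  obtain ⟨e, he⟩ := hnd
  have : 1 < (ϑ.image e).card := by
    have := (ϑ.image_nonempty e).card_pos
    omega
  obtain ⟨β, hβ, β', hβ', hne⟩ := Finset.one_lt_card.1 this
  exact ⟨e, β, hβ, β', hβ', hne⟩

theorem two_le_length [DecidableEq A] (hnd : ¬ ϑ.Degenerate) (hc : ϑ.Compatible)
    (hL : ∀ a, ∀ u ∈ ϑ.image a, u.length = L) : 2 ≤ L := by
  obtain ⟨e, β, hβ, β', hβ', hne⟩ := exists_two_images hnd
  by_contra hlt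
  apply hne
  have hp : β.Perm β' := List.perm_iff_count.2 (hc e β hβ β' hβ')
  have h1 := hL e β hβ
  match β, h1 with
  | [], _ => exact (List.nil_perm.1 hp).symm
  | [b], _ => exact (List.singleton_perm.1 hp)
  | _ :: _ :: _, h1 => simp at h1; omega

theorem exists_ne_letter (hnd : ¬ ϑ.Degenerate) (hL : ∀ a, ∀ u ∈ ϑ.image a, u.length = L)
    (a : A) : ∃ b, b ≠ a := by
  by_contra hcon
  push Not at hcon
  obtain ⟨e, β, hβ, β', hβ', hne⟩ := exists_two_images hnd
  apply hne
  rw [List.eq_replicate_of_mem (l := β) (a := a) fun b _ => hcon b,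
    List.eq_replicate_of_mem (l := β') (a := a) fun b _ => hcon b, hL e β hβ, hL e β' hβ']

end Degenerate


/-! ### Inflation word decompositions induced by realisations -/

section Decompositions

variable {A : Type*} {ϑ : RandomSubstitution A} {L : ℕ}

theorem flatten_dropLetters (i : ℕ) (d : List (List A × A)) :
    ((dropLetters i d).map Prod.fst).flatten = ((d.map Prod.fst).flatten).drop i := by
  induction d generalizing i with
  | nil => simp [dropLetters]
  | cons q d ih =>
    obtain ⟨p, a⟩ := q
    by_cases h : i < p.length
    · simp [dropLetters, h, List.drop_append, Nat.sub_eq_zero_of_le h.le]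
    · simp [dropLetters, h, ih, List.drop_append, List.drop_of_length_le (not_lt.1 h)]

theorem flatten_takeLetters (n : ℕ) (d : List (List A × A)) :
    ((takeLetters n d).map Prod.fst).flatten = ((d.map Prod.fst).flatten).take n := by
  induction d generalizing n with
  | nil => simp [takeLetters]
  | cons q d ih =>
    obtain ⟨p, a⟩ := q
    by_cases h : n ≤ p.length
    · simp [takeLetters, h, List.take_append, Nat.sub_eq_zero_of_le h]
    · simp [takeLetters, h, ih, List.take_append, List.take_of_length_le (not_le.1 h).le]

theorem exists_dropLetters_eq {i : ℕ} {d : List (List A × A)}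
    (h : i < ((d.map Prod.fst).flatten).length) :
    ∃ pre p a tail j, d = pre ++ (p, a) :: tail ∧ j < p.length ∧
      i = ((pre.map Prod.fst).flatten).length + j ∧ dropLetters i d = (p.drop j, a) :: tail := by
  induction d generalizing i with
  | nil => simp at h
  | cons q d ih =>
    obtain ⟨p, a⟩ := q
    by_cases hi : i < p.length
    · exact ⟨[], p, a, d, i, rfl, hi, by simp, by simp [dropLetters, hi]⟩
    · obtain ⟨pre, p', a', tail, j, rfl, hj, hij, e⟩ := ih (i := i - p.length) (by
        simp only [List.map_cons, List.flatten_cons, List.length_append] at h; omega)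
      refine ⟨(p, a) :: pre, p', a', tail, j, rfl, hj, ?_,
        by simp only [dropLetters, hi, if_false, e]⟩
      simp only [List.map_cons, List.flatten_cons, List.length_append]; omega

theorem exists_takeLetters_eq {n : ℕ} {d : List (List A × A)} (hn : 1 ≤ n)
    (h : n ≤ ((d.map Prod.fst).flatten).length) :
    ∃ pre p a tail j, d = pre ++ (p, a) :: tail ∧ 1 ≤ j ∧ j ≤ p.length ∧
      takeLetters n d = pre ++ [(p.take j, a)] := by
  induction d generalizing n with
  | nil => simp at h; omega
  | cons q d ih =>
    obtain ⟨p, a⟩ := q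
    by_cases hi : n ≤ p.length
    · exact ⟨[], p, a, d, n, rfl, hn, hi, by simp [takeLetters, hi]⟩
    · obtain ⟨pre, p', a', tail, j, rfl, hj, hj', e⟩ := ih (n := n - p.length) (by omega) (by
        simp only [List.map_cons, List.flatten_cons, List.length_append] at h; omega)
      exact ⟨(p, a) :: pre, p', a', tail, j, rfl, hj, hj',
        by simp only [takeLetters, hi, if_false, e, List.cons_append]⟩

theorem dropLetters_dropLetters (i N : ℕ) (d : List (List A × A)) :
    dropLetters N (dropLetters i d) = dropLetters (i + N) d := by
  induction d generalizing i with
  | nil => simp [dropLetters]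
  | cons q d ih =>
    obtain ⟨p, a⟩ := q
    by_cases h : i < p.length
    · by_cases h' : i + N < p.length
      · simp [dropLetters, h, h', show N < p.length - i by omega]
      · simp [dropLetters, h, h', show ¬ N < p.length - i by omega,
          show N - (p.length - i) = i + N - p.length by omega]
    · simp [dropLetters, h, show ¬ i + N < p.length by omega, ih,
        show i - p.length + N = i + N - p.length by omega]

theorem dropLetters_takeLetters {N m : ℕ} (h : N < m) (d : List (List A × A)) :
    dropLetters N (takeLetters m d) = takeLetters (m - N) (dropLetters N d) := by
  induction d generalizing N m with
  | nil => simp [dropLetters, takeLetters]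
  | cons q d ih =>
    obtain ⟨p, a⟩ := q
    by_cases hm : m ≤ p.length
    · simp [dropLetters, takeLetters, hm, h, show N < p.length by omega,
        show m ≤ p.length - N + N by omega, List.drop_take]
    · by_cases hN : N < p.length
      · simp [dropLetters, takeLetters, hm, hN, show ¬ m ≤ p.length - N + N by omega,
          show m - N - (p.length - N) = m - p.length by omega]
      · simp [dropLetters, takeLetters, hm, hN,
          ih (show N - p.length < m - p.length by omega),
          show m - p.length - (N - p.length) = m - N by omega]

theorem takeLetters_takeLetters {n m : ℕ} (h : n ≤ m) (d : List (List A × A)) :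
    takeLetters n (takeLetters m d) = takeLetters n d := by
  induction d generalizing n m with
  | nil => simp [takeLetters]
  | cons q d ih =>
    obtain ⟨p, a⟩ := q
    by_cases hm : m ≤ p.length
    · simp [takeLetters, hm, h, show n ≤ p.length by omega, List.take_take]
    · by_cases hn : n ≤ p.length
      · simp [takeLetters, hm, hn]
      · simp [takeLetters, hm, hn, ih (show n - p.length ≤ m - p.length by omega)]

theorem induced_induced {i m N n : ℕ} (d : List (List A × A)) (hn : 1 ≤ n) (h : N + n ≤ m) :
    induced (induced d i m) N n = induced d (i + N) n := by
  rw [induced, induced, dropLetters_takeLetters (by omega), dropLetters_dropLetters,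
    takeLetters_takeLetters (by omega), induced]

theorem exists_full_decomposition {z V : List A} (h : V ∈ ϑ.imageWord z) :
    ∃ d : List (List A × A), d.map Prod.snd = z ∧ (d.map Prod.fst).flatten = V ∧
      ∀ q ∈ d, q.1 ∈ ϑ.image q.2 := by
  induction z generalizing V with
  | nil => exact ⟨[], rfl, h.symm, by simp⟩
  | cons a z ih =>
    obtain ⟨s, hs, t, ht, rfl⟩ := h
    obtain ⟨d, h1, h2, h3⟩ := ih ht
    refine ⟨(s, a) :: d, by simp [h1], by simp [h2], ?_⟩
    exact List.forall_mem_cons.2 ⟨hs, h3⟩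

/-- Restricting complete inflation words to a window truncates only the first and last pieces. This
is how decompositions are fed to the recognisability hypothesis. -/
theorem isDecomposition_induced {d : List (List A × A)} (hd : ∀ q ∈ d, q.1 ∈ ϑ.image q.2)
    (hleg : ϑ.Legal (d.map Prod.snd)) {P w Q : List A}
    (h : (d.map Prod.fst).flatten = P ++ w ++ Q) (hw : w ≠ []) :
    ϑ.IsDecomposition w (induced d P.length w.length) := by
  have hw1 : 1 ≤ w.length := List.length_pos_of_ne_nil hw
  have hflat : ((induced d P.length w.length).map Prod.fst).flatten = w := by
    rw [induced, flatten_takeLetters, flatten_dropLetters, h]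
    simp
  have hlen : ((dropLetters P.length d).map Prod.fst).flatten.length = w.length + Q.length := by
    rw [flatten_dropLetters, h]; simp
  refine ⟨hflat, ?_⟩
  obtain ⟨pre, p, a, tail, j, rfl, hj, -, e⟩ := exists_dropLetters_eq (i := P.length) (d := d)
    (by rw [h]; simp; omega)
  obtain ⟨pre', p', a', tail', j', e', hj1, hj2, e2⟩ :=
    exists_takeLetters_eq (d := dropLetters P.length (pre ++ (p, a) :: tail)) hw1 (by omega)
  rw [induced, e2]
  rw [e] at e'
  have hpa : p ∈ ϑ.image a := hd (p, a) (by simp)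
  have htail : ∀ q ∈ tail, q.1 ∈ ϑ.image q.2 := fun q hq => hd q (by simp [hq])
  have hnn : ∀ q ∈ tail, q.1 ≠ [] := fun q hq hq' =>
    ϑ.nil_notMem_image q.2 (hq' ▸ htail q hq)
  obtain _ | ⟨q, pre'⟩ := pre'
  · simp only [List.nil_append, List.cons.injEq, Prod.mk.injEq] at e'
    obtain ⟨⟨rfl, rfl⟩, rfl⟩ := e'
    rw [List.length_drop] at hj2
    refine ⟨?_, ?_, ?_⟩
    · simp only [List.nil_append, List.mem_singleton, forall_eq, ne_eq, List.take_eq_nil_iff,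
        List.drop_eq_nil_iff]
      omega
    · exact legal_singleton a
    · intro k hk
      obtain rfl : k = 0 := by simpa using hk
      refine ⟨p.take j, (p.drop j).drop j', ?_, by simp, by simp⟩
      simpa using hpa
  · simp only [List.cons_append, List.cons.injEq] at e'
    obtain ⟨rfl, rfl⟩ := e'
    have hpa' : p' ∈ ϑ.image a' := htail (p', a') (by simp)
    refine ⟨?_, ?_, ?_⟩
    · intro q hq
      simp only [List.cons_append, List.mem_cons, List.mem_append, List.not_mem_nil,
        or_false] at hq
      rcases hq with rfl | hq | rfl
      · simpa using hj
      · exact hnn q (by simp [hq])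
      · simp only [ne_eq, List.take_eq_nil_iff]
        rintro (h0 | h0)
        · omega
        · rw [h0] at hj2; simp at hj2; omega
    · refine hleg.infix ⟨pre.map Prod.snd, tail'.map Prod.snd, ?_⟩ (by simp)
      simp
    · intro k hk
      obtain _ | k := k
      · exact ⟨p.take j, [], by simpa using hpa, by simp, by simp⟩
      · simp only [List.cons_append, List.length_cons, List.length_append, List.length_nil,
          zero_add] at hk
        by_cases hk' : k < pre'.length
        · refine ⟨[], [], ?_, by simp, by simp⟩
          simp only [List.cons_append, List.getElem_cons_succ, List.getElem_append_left hk',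
            List.nil_append, List.append_nil]
          exact htail _ (by simp)
        · obtain rfl : k = pre'.length := by omega
          refine ⟨[], p'.drop j', ?_, by simp, ?_⟩
          · simpa using hpa'
          · simp

theorem exists_dropLetters_full (hL : ∀ a, ∀ u ∈ ϑ.image a, u.length = L)
    {d : List (List A × A)} (hd : ∀ q ∈ d, q.1 ∈ ϑ.image q.2) {i : ℕ}
    (hi : i < ((d.map Prod.fst).flatten).length) :
    ∃ (p : List A) (a : A) (tail : List (List A × A)),
      dropLetters i d = (p.drop (i % L), a) :: tail ∧ p.length = L ∧
      i % L < L ∧ (d.map Prod.snd)[i / L]? = some a := by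
  obtain ⟨pre, p, a, tail, j, rfl, hj, rfl, e⟩ := exists_dropLetters_eq hi
  have hp : p.length = L := hL a p (hd (p, a) (by simp))
  have hpre : ((pre.map Prod.fst).flatten).length = L * pre.length := by
    clear e hi
    induction pre with
    | nil => simp
    | cons q pre ih =>
      have h1 := hL q.2 q.1 (hd q (by simp))
      have h2 := ih fun q' hq' => hd q'
        (by simp only [List.cons_append, List.mem_cons, hq', or_true])
      simp only [List.map_cons, List.flatten_cons, List.length_append, h1, h2, List.length_cons]
      ring
  rw [hp] at hj
  have h1 : (L * pre.length + j) % L = j := by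
    rw [Nat.mul_add_mod, Nat.mod_eq_of_lt hj]
  have h2 : (L * pre.length + j) / L = pre.length := by
    rw [Nat.mul_add_div (by omega), Nat.div_eq_of_lt hj, add_zero]
  rw [hpre] at e ⊢
  refine ⟨p, a, tail, by rw [h1, e], hp, by rw [h1]; exact hj, ?_⟩
  rw [h2]
  simp

/-- If a recognisable word has two different positions relative to the inflation words of two
realisations, then it is not cut in either of them, and it lies in inflation words of the same
type. -/
theorem uncut_of_recognisable (hL : ∀ a, ∀ u ∈ ϑ.image a, u.length = L) {u : List A} {N : ℕ}
    (hu : u ≠ [])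
    (hrec : ∀ l r : List A, l.length = N → r.length = N → ϑ.Legal (l ++ u ++ r) →
      ∀ d d' : List (List A × A),
      ϑ.IsDecomposition (l ++ u ++ r) d → ϑ.IsDecomposition (l ++ u ++ r) d' →
      induced d N u.length = induced d' N u.length)
    {z z' l r P P' Q Q' : List A} (hz : ϑ.Legal z) (hz' : ϑ.Legal z')
    (hl : l.length = N) (hr : r.length = N)
    (hV : P ++ (l ++ u ++ r) ++ Q ∈ ϑ.imageWord z)
    (hV' : P' ++ (l ++ u ++ r) ++ Q' ∈ ϑ.imageWord z')
    (hne : (P.length + N) % L ≠ (P'.length + N) % L) :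
    (P.length + N) % L + u.length ≤ L ∧ (P'.length + N) % L + u.length ≤ L ∧
      z[(P.length + N) / L]? = z'[(P'.length + N) / L]? := by
  have hu1 : 1 ≤ u.length := List.length_pos_of_ne_nil hu
  obtain ⟨d, rfl, hd2, hd3⟩ := exists_full_decomposition hV
  obtain ⟨d', rfl, hd2', hd3'⟩ := exists_full_decomposition hV'
  have hne0 : l ++ u ++ r ≠ [] := by simp [hu]
  have hleg : ϑ.Legal (l ++ u ++ r) :=
    (hz.imageWord hV (by simp [hu])).infix ⟨P, Q, by simp⟩ hne0
  have key := hrec l r hl hr hleg _ _ (isDecomposition_induced hd3 hz hd2 hne0)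
    (isDecomposition_induced hd3' hz' hd2' hne0)
  rw [induced_induced _ hu1 (by simp; omega), induced_induced _ hu1 (by simp; omega)] at key
  obtain ⟨p, a, tail, e, hp, hlt, ha⟩ := exists_dropLetters_full hL hd3 (i := P.length + N)
    (by rw [hd2]; simp; omega)
  obtain ⟨p', a', tail', e', hp', hlt', ha'⟩ := exists_dropLetters_full hL hd3'
    (i := P'.length + N) (by rw [hd2']; simp; omega)
  rw [ha, ha']
  generalize (P.length + N) % L = j at *
  generalize (P'.length + N) % L = j' at *
  simp only [induced, e, e', takeLetters, List.length_drop, hp, hp'] at key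
  -- The first induced piece has length `min u.length (L - offset)`. With different offsets these
  -- lengths can agree only if both equal `u.length`, that is, if `u` is uncut on both sides.
  by_cases h1 : u.length ≤ L - j <;> by_cases h2 : u.length ≤ L - j'
  · simp only [h1, h2, if_true, List.cons.injEq, Prod.mk.injEq] at key
    exact ⟨by omega, by omega, by rw [key.1.2]⟩
  all_goals
    simp only [h1, h2, if_true, if_false, List.cons.injEq, Prod.mk.injEq] at key
    have := congrArg List.length key.1.1
    simp only [List.length_take, List.length_drop, hp, hp'] at this
    omega

end Decompositions


theorem exists_eq_append_of_aligned {A : Type*} {X u Y p w q : List A}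
    (h : X ++ u ++ Y = p ++ w ++ q) (h1 : p.length ≤ X.length)
    (h2 : X.length + u.length ≤ p.length + w.length) :
    ∃ a b, w = a ++ u ++ b ∧ X = p ++ a := by
  have hp : p <+: X := List.prefix_of_prefix_length_le (l₃ := X ++ u ++ Y)
    ⟨w ++ q, by rw [h, List.append_assoc]⟩ ⟨u ++ Y, by simp⟩ h1
  obtain ⟨a, rfl⟩ := hp
  have h' : a ++ u ++ Y = w ++ q := by simpa using h
  have hw : a ++ u <+: w := List.prefix_of_prefix_length_le (l₃ := w ++ q)
    ⟨Y, h'⟩ ⟨q, rfl⟩ (by simp only [List.length_append] at h2 ⊢; omega)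
  obtain ⟨b, rfl⟩ := hw
  exact ⟨a, b, rfl, rfl⟩

/-! ### From a recognisable word to a synchronising word -/

section Synchronisation

variable {A : Type*} {ϑ : RandomSubstitution A} {L : ℕ}

theorem exists_block (hL : ∀ a, ∀ u ∈ ϑ.image a, u.length = L) {z V : List A}
    (hV : V ∈ ϑ.imageWord z) {k : ℕ} (hk : L * k < V.length) :
    ∃ z₁ v z₂ p w q, z = z₁ ++ v :: z₂ ∧ z₁.length = k ∧ V = p ++ w ++ q ∧ p.length = L * k ∧
      p ∈ ϑ.imageWord z₁ ∧ w ∈ ϑ.image v ∧ q ∈ ϑ.imageWord z₂ := by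
  have hlen := length_of_mem_imageWord hL hV
  have hkz : k < z.length := by
    rw [hlen] at hk
    exact Nat.lt_of_mul_lt_mul_left hk
  have hpl : (V.take (L * k)).length = L * k := by simp; omega
  have h := hV
  rw [← List.take_append_drop (L * k) V] at h
  obtain ⟨h1, h2⟩ := mem_imageWord_split hL h hpl hkz.le
  obtain ⟨v, z₂, hv⟩ := List.exists_cons_of_ne_nil (l := z.drop k) (by simp; omega)
  rw [hv] at h2
  obtain ⟨w, hw, q, hq, e⟩ := h2
  refine ⟨z.take k, v, z₂, _, w, q, ?_, by simp; omega, ?_, hpl, h1, hw, hq⟩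
  · rw [← hv, List.take_append_drop]
  · rw [List.append_assoc, ← e, List.take_append_drop]

theorem exists_extend_image (h : ϑ.Primitive) (hL : ∀ a, ∀ u ∈ ϑ.image a, u.length = L)
    (hL2 : 2 ≤ L) {z V : List A} (hz : ϑ.Legal z) (hV : V ∈ ϑ.imageWord z) (n : ℕ) :
    ∃ z' V₁ V₂, ϑ.Legal z' ∧ V₁ ++ V ++ V₂ ∈ ϑ.imageWord z' ∧ n ≤ V₁.length ∧
      n ≤ V₂.length ∧ L ∣ V₁.length := by
  obtain ⟨p, q, hp, hq, hpq⟩ := hz.exists_extend h hL hL2 n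
  obtain ⟨V₁, h₁⟩ := ϑ.imageWord_nonempty p
  obtain ⟨V₂, h₂⟩ := ϑ.imageWord_nonempty q
  have l₁ := length_of_mem_imageWord hL h₁
  have l₂ := length_of_mem_imageWord hL h₂
  refine ⟨_, V₁, V₂, hpq, append_mem_imageWord (append_mem_imageWord h₁ hV) h₂, ?_, ?_, ?_⟩
  · rw [l₁, hp]; exact Nat.le_mul_of_pos_left _ (by omega)
  · rw [l₂, hq]; exact Nat.le_mul_of_pos_left _ (by omega)
  · rw [l₁]; exact dvd_mul_right _ _

/-- Every realisation of a legal word occurs, displaced by `n` modulo `L`, in a realisation of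
another legal word. -/
def Shiftable (ϑ : RandomSubstitution A) (L n : ℕ) : Prop :=
  ∀ z V, ϑ.Legal z → V ∈ ϑ.imageWord z → ∃ z' p q, ϑ.Legal z' ∧ p ++ V ++ q ∈ ϑ.imageWord z' ∧
    p.length % L = n % L

theorem Shiftable.add {m n : ℕ} (hm : ϑ.Shiftable L m) (hn : ϑ.Shiftable L n) :
    ϑ.Shiftable L (m + n) := by
  intro z V hz hV
  obtain ⟨z', p, q, hz', hV', e⟩ := hm z V hz hV
  obtain ⟨z'', p', q', hz'', hV'', e'⟩ := hn z' _ hz' hV'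
  refine ⟨z'', p' ++ p, q ++ q', hz'', by simpa using hV'', ?_⟩
  rw [List.length_append, Nat.add_mod, e, e', ← Nat.add_mod, add_comm]

theorem Shiftable.mul {n : ℕ} (hn : ϑ.Shiftable L n) (k : ℕ) : ϑ.Shiftable L (n * k) := by
  induction k with
  | zero => exact fun z V hz hV => ⟨z, [], [], hz, by simpa using hV, by simp⟩
  | succ k ih => exact ih.add hn

/-- The positions modulo `L` at which `s` occurs in realisations of legal words. -/
def residues (ϑ : RandomSubstitution A) (L : ℕ) (s : List A) : Set ℕ :=
  {ρ | ∃ z p q, ϑ.Legal z ∧ p ++ s ++ q ∈ ϑ.imageWord z ∧ p.length % L = ρ}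

theorem finite_residues (hL0 : 0 < L) (s : List A) : (ϑ.residues L s).Finite := by
  refine (Set.finite_lt_nat L).subset ?_
  rintro _ ⟨z, p, q, _, _, rfl⟩
  exact Nat.mod_lt _ hL0

/-- Choose a realisation `s` with the fewest residues. Extending `s` to `s ++ M ++ V` can only
remove residues, so by minimality it removes none. As `s` and `M` have lengths divisible by `L`,
every residue of `s`, in particular a nonzero one, is a displacement available to every `V`. -/
theorem exists_shiftable [Nonempty A] (h : ϑ.Primitive)
    (hL : ∀ a, ∀ u ∈ ϑ.image a, u.length = L) (hL2 : 2 ≤ L)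
    (hns : ∀ t s, ϑ.Legal t → s ∈ ϑ.imageWord t →
      ∃ z p q, ϑ.Legal z ∧ p ++ s ++ q ∈ ϑ.imageWord z ∧ ¬ L ∣ p.length) :
    ∃ n, ¬ L ∣ n ∧ ϑ.Shiftable L n := by
  let S : Set ℕ := {c | ∃ t s, ϑ.Legal t ∧ s ∈ ϑ.imageWord t ∧ (ϑ.residues L s).ncard = c}
  have hS : S.Nonempty := by
    obtain ⟨a⟩ := ‹Nonempty A›
    obtain ⟨s, hs⟩ := ϑ.imageWord_nonempty [a]
    exact ⟨_, [a], s, legal_singleton a, hs, rfl⟩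
  obtain ⟨t, s, ht, hs, hc⟩ := Nat.sInf_mem hS
  obtain ⟨z, p, q, hz, hp, hn⟩ := hns t s ht hs
  refine ⟨p.length, hn, fun y V hy hV => ?_⟩
  obtain ⟨m, hm⟩ := ht.exists_append h hL hL2 hy
  obtain ⟨M, hM⟩ := ϑ.imageWord_nonempty m
  have hV' := append_mem_imageWord (append_mem_imageWord hs hM) hV
  have hsub : ϑ.residues L (s ++ M ++ V) ⊆ ϑ.residues L s := by
    rintro _ ⟨z, p, q, hz, hpq, rfl⟩
    exact ⟨z, p, M ++ V ++ q, hz, by simpa using hpq, rfl⟩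
  have hle : (ϑ.residues L s).ncard ≤ (ϑ.residues L (s ++ M ++ V)).ncard := by
    rw [hc]
    exact Nat.sInf_le ⟨_, _, hm, hV', rfl⟩
  have heq := Set.eq_of_subset_of_ncard_le hsub hle (finite_residues (by omega) s)
  obtain ⟨z', p', q', hz', hV'', e⟩ : p.length % L ∈ ϑ.residues L (s ++ M ++ V) := by
    rw [heq]; exact ⟨z, p, q, hz, hp, rfl⟩
  refine ⟨z', p' ++ s ++ M, q', hz', by simpa using hV'', ?_⟩
  rw [List.length_append, List.length_append, length_of_mem_imageWord hL hs,
    length_of_mem_imageWord hL hM, Nat.add_mul_mod_self_left, Nat.add_mul_mod_self_left, e]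

/-- Displacements add, so all multiples of `n` modulo `L` are available, among them `n.gcd L`. -/
theorem exists_dvd_shiftable [Nonempty A] (h : ϑ.Primitive)
    (hL : ∀ a, ∀ u ∈ ϑ.image a, u.length = L) (hL2 : 2 ≤ L)
    (hns : ∀ t s, ϑ.Legal t → s ∈ ϑ.imageWord t →
      ∃ z p q, ϑ.Legal z ∧ p ++ s ++ q ∈ ϑ.imageWord z ∧ ¬ L ∣ p.length) :
    ∃ j, 0 < j ∧ j < L ∧ j ∣ L ∧ ϑ.Shiftable L j := by
  obtain ⟨n, hn, hs⟩ := exists_shiftable h hL hL2 hns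
  have hlt : n.gcd L < L := lt_of_le_of_ne (Nat.gcd_le_right _ (by omega))
    fun e => hn (e ▸ Nat.gcd_dvd_left n L)
  obtain ⟨m, -, hm⟩ := Nat.exists_mul_mod_eq_gcd hlt
  refine ⟨n.gcd L, Nat.gcd_pos_of_pos_right _ (by omega), hlt, Nat.gcd_dvd_right _ _, ?_⟩
  intro z V hz hV
  obtain ⟨z', p, q, hz', hV', e⟩ := hs.mul m z V hz hV
  exact ⟨z', p, q, hz', hV', by rw [e, hm, Nat.mod_eq_of_lt hlt]⟩

/-- All occurrences of the word in realisations of legal words are aligned with the inflation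
words. -/
def Synchronising (ϑ : RandomSubstitution A) (L : ℕ) (s : List A) : Prop :=
  ∀ z p q, ϑ.Legal z → p ++ s ++ q ∈ ϑ.imageWord z → L ∣ p.length

theorem Synchronising.infix {s w : List A} {k : ℕ} (hs : ϑ.Synchronising L s) {a b : List A}
    (hw : w = a ++ s ++ b) (ha : a.length = L * k) : ϑ.Synchronising L w := by
  subst hw
  intro z p q hz h
  have := hs z (p ++ a) (b ++ q) hz (by simpa using h)
  rw [List.length_append, ha] at this
  exact (Nat.dvd_add_left (dvd_mul_right L k)).1 this

section Periodic

variable {u : List A} {N j : ℕ}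

/-- In a realisation of a legal word, the inflation word `w = w₁ ++ w'` can be moved to the right
by `|w₁|`. -/
theorem exists_move_right (h : ϑ.Primitive) (hL : ∀ a, ∀ u ∈ ϑ.image a, u.length = L)
    (hL2 : 2 ≤ L) (hdisj : ϑ.DisjointImagesOfLetters) (hu : u ≠ [])
    (hrec : ∀ l r : List A, l.length = N → r.length = N → ϑ.Legal (l ++ u ++ r) →
      ∀ d d' : List (List A × A),
      ϑ.IsDecomposition (l ++ u ++ r) d → ϑ.IsDecomposition (l ++ u ++ r) d' →
      induced d N u.length = induced d' N u.length)
    (hj0 : 0 < j) (hjL : j < L) (hs : ϑ.Shiftable L (L - j))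
    {v : A} {w₁ c d : List A} (hw : w₁ ++ c ++ u ++ d ∈ ϑ.image v) (hw₁ : w₁.length = j)
    {z p q : List A} (hz : ϑ.Legal z) (hV : p ++ (w₁ ++ c ++ u ++ d) ++ q ∈ ϑ.imageWord z)
    (hp : L ∣ p.length) :
    ∃ z' P q', ϑ.Legal z' ∧ P ++ p ++ w₁ ++ (w₁ ++ c ++ u ++ d) ++ q' ∈ ϑ.imageWord z' ∧
      L ∣ (P ++ p ++ w₁).length := by
  have hu1 : 1 ≤ u.length := List.length_pos_of_ne_nil hu
  obtain ⟨zx, V₁, V₂, hzx, hVx, h₁, h₂, h₃⟩ := exists_extend_image h hL hL2 hz hV (N + j)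
  obtain ⟨P, hP⟩ : ∃ P, V₁ ++ p = P := ⟨_, rfl⟩
  obtain ⟨Q, hQ⟩ : ∃ Q, q ++ V₂ = Q := ⟨_, rfl⟩
  have hPl : N + j ≤ P.length := by rw [← hP, List.length_append]; omega
  have hQl : N + j ≤ Q.length := by rw [← hQ, List.length_append]; omega
  have hPd : L ∣ P.length := by rw [← hP, List.length_append]; exact dvd_add h₃ hp
  have hwl : j + c.length + u.length + d.length = L := by
    rw [← hL v _ hw, ← hw₁]; simp [add_assoc]
  replace hVx : P ++ (w₁ ++ c ++ u ++ d) ++ Q ∈ ϑ.imageWord zx := by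
    rw [← hP, ← hQ]; simpa using hVx
  -- After this displacement an inflation word boundary falls immediately after `w₁`, and `u` sits
  -- at offset `c.length` instead of `j + c.length`.
  obtain ⟨z', P', Q', hz', hV', e⟩ := hs zx _ hzx hVx
  rw [Nat.mod_eq_of_lt (show L - j < L by omega)] at e
  obtain ⟨X, l, hXl, hl⟩ : ∃ X l, P ++ w₁ ++ c = X ++ l ∧ l.length = N :=
    ⟨_, _, (List.take_append_drop ((P ++ w₁ ++ c).length - N) _).symm, by simp; omega⟩
  obtain ⟨r, Y, hrY, hr⟩ : ∃ r Y, d ++ Q = r ++ Y ∧ r.length = N :=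
    ⟨_, _, (List.take_append_drop N _).symm, by simp; omega⟩
  have eV : P ++ (w₁ ++ c ++ u ++ d) ++ Q = X ++ (l ++ u ++ r) ++ Y := by
    calc _ = (P ++ w₁ ++ c) ++ u ++ (d ++ Q) := by simp
      _ = _ := by rw [hXl, hrY]; simp
  have eV' : P' ++ (P ++ (w₁ ++ c ++ u ++ d) ++ Q) ++ Q' =
      (P' ++ X) ++ (l ++ u ++ r) ++ (Y ++ Q') := by rw [eV]; simp
  have hXN : X.length + N = P.length + j + c.length := by
    have := congrArg List.length hXl
    simp only [List.length_append] at this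
    omega
  obtain ⟨kp, hkp⟩ := hPd
  have hP'm := Nat.mod_add_div P'.length L
  rw [e] at hP'm
  obtain ⟨kP, hkP⟩ : ∃ k, P'.length + P.length + j = L * k :=
    ⟨P'.length / L + kp + 1, by rw [mul_add, mul_add, ← hkp]; omega⟩
  have m1 : (X.length + N) % L = j + c.length ∧ (X.length + N) / L = kp := by
    rw [hXN, hkp, add_assoc]
    exact ⟨by rw [Nat.mul_add_mod, Nat.mod_eq_of_lt (by omega)],
      by rw [Nat.mul_add_div (by omega), Nat.div_eq_of_lt (by omega), add_zero]⟩
  have m2 : ((P' ++ X).length + N) % L = c.length ∧ ((P' ++ X).length + N) / L = kP := by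
    have : (P' ++ X).length + N = L * kP + c.length := by
      rw [List.length_append]; omega
    rw [this]
    exact ⟨by rw [Nat.mul_add_mod, Nat.mod_eq_of_lt (by omega)],
      by rw [Nat.mul_add_div (by omega), Nat.div_eq_of_lt (by omega), add_zero]⟩
  obtain ⟨-, -, key⟩ := uncut_of_recognisable hL hu hrec hzx hz' hl hr (eV ▸ hVx) (eV' ▸ hV')
    (by rw [m1.1, m2.1]; omega)
  rw [m1.2, m2.2] at key
  obtain ⟨z₁, v₁, z₂, p₁, b₁, q₁, rfl, hz₁, e₁, hp₁, -, hb₁, -⟩ :=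
    exists_block hL hVx (k := kp) (by simp only [List.length_append]; omega)
  obtain ⟨z₁', v₁', z₂', p₁', b₁', q₁', rfl, hz₁', e₁', hp₁', hp', -, hq'⟩ :=
    exists_block hL hV' (k := kP) (by simp only [List.length_append]; omega)
  have hv : v₁ = v := by
    rw [List.append_assoc P, List.append_assoc p₁] at e₁
    obtain ⟨-, e₂⟩ := List.append_inj e₁ (by omega)
    obtain ⟨e₃, -⟩ := List.append_inj e₂ (by rw [hL _ _ hw, hL _ _ hb₁])
    exact hdisj _ _ ⟨b₁, hb₁, e₃ ▸ hw⟩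
  have hv' : v₁' = v := by
    simp only [← hz₁, ← hz₁', List.getElem?_append_right le_rfl, Nat.sub_self,
      List.getElem?_cons_zero, Option.some.injEq] at key
    rw [← key, hv]
  have hpe : p₁' = P' ++ P ++ w₁ := by
    have : (P' ++ P ++ w₁) ++ (c ++ u ++ d ++ Q ++ Q') = p₁' ++ (b₁' ++ q₁') := by
      rw [← List.append_assoc p₁', ← e₁']; simp
    exact (List.append_inj this (by simp only [List.length_append]; omega)).1.symm
  subst hv'
  refine ⟨_, P' ++ V₁, q₁', hz', ?_, kP, ?_⟩
  -- The block starting just after `w₁` also has type `v` by recognisability, so it may be realised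
  -- by `w` itself.
  · have : P' ++ V₁ ++ p ++ w₁ = p₁' := by rw [hpe, ← hP]; simp
    rw [this, List.append_assoc]
    exact append_mem_imageWord hp' ⟨_, hw, _, hq', rfl⟩
  · have := congrArg List.length hP
    simp only [List.length_append] at this ⊢
    omega

theorem mem_image_of_replicate (hL : ∀ a, ∀ u ∈ ϑ.image a, u.length = L) {B : List A}
    (hB : B.length = L) {n : ℕ} {z : List A} (h : (List.replicate n B).flatten ∈ ϑ.imageWord z)
    (hz : z.length = n) : ∀ a ∈ z, B ∈ ϑ.image a := by
  induction n generalizing z with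
  | zero => simp [List.length_eq_zero_iff.1 hz]
  | succ n ih =>
    obtain _ | ⟨b, z⟩ := z
    · simp at hz
    obtain ⟨s, hs, t, ht, e⟩ := h
    rw [List.replicate_succ, List.flatten_cons] at e
    obtain ⟨rfl, rfl⟩ := List.append_inj e (by rw [hB, hL _ _ hs])
    exact List.forall_mem_cons.2 ⟨hs, ih ht (by simpa using hz)⟩

theorem flatten_replicate_mul (r n : ℕ) (w : List A) :
    (List.replicate (r * n) w).flatten =
      (List.replicate n (List.replicate r w).flatten).flatten := by
  induction n with
  | zero => simp
  | succ n ih =>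
    rw [mul_add, mul_one, add_comm, List.replicate_add, List.flatten_append, ih,
      List.replicate_succ, List.flatten_cons]

end Periodic

/-- By contradiction: displaceability by a proper divisor of `L` and recognisability together
produce long periodic realisations whose period divides `L`, and these belong to all letters at
once. -/
theorem exists_synchronising [DecidableEq A] (hnd : ¬ ϑ.Degenerate) (h : ϑ.Primitive)
    (hc : ϑ.Compatible) (hdisj : ϑ.DisjointImagesOfLetters) (hrec : ϑ.AdmitsRecognisableWord)
    (hL : ∀ a, ∀ u ∈ ϑ.image a, u.length = L) :
    ∃ t s, ϑ.Legal t ∧ s ∈ ϑ.imageWord t ∧ ϑ.Synchronising L s := by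
  have hL2 := two_le_length hnd hc hL
  by_contra hcon
  have hns : ∀ t s, ϑ.Legal t → s ∈ ϑ.imageWord t →
      ∃ z p q, ϑ.Legal z ∧ p ++ s ++ q ∈ ϑ.imageWord z ∧ ¬ L ∣ p.length := by
    intro t s ht hs
    by_contra hcon'
    refine hcon ⟨t, s, ht, hs, fun z p q hz hp => ?_⟩
    by_contra hd
    exact hcon' ⟨z, p, q, hz, hp, hd⟩
  obtain ⟨e₀, -⟩ := exists_two_images hnd
  have : Nonempty A := ⟨e₀⟩
  obtain ⟨j, hj0, hjL, ⟨r, hr⟩, hs⟩ := exists_dvd_shiftable h hL hL2 hns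
  have hr2 : 2 ≤ r := by
    by_contra hlt
    have : r = 0 ∨ r = 1 := by omega
    rcases this with rfl | rfl <;> omega
  have h2j : 2 * j ≤ L := by rw [hr, mul_comm j]; exact Nat.mul_le_mul_right j hr2
  have hs' : ϑ.Shiftable L (L - j) := by
    have := hs.mul (r - 1)
    rwa [Nat.mul_sub, mul_one, ← hr] at this
  obtain ⟨u, hul, N, hrec⟩ := hrec
  have hu : u ≠ [] := hul.1
  have hu1 : 1 ≤ u.length := List.length_pos_of_ne_nil hu
  obtain ⟨l, rr, hl, hrr, hlur⟩ := hul.exists_extend h hL hL2 N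
  -- An offset of at least `j` leaves room for the prefix `w₁` before `u`. A smaller offset is
  -- raised by one displacement by `j`, without wrapping around since `2 * j ≤ L`.
  obtain ⟨z, P, Q, hz, hV, hge⟩ : ∃ z P Q, ϑ.Legal z ∧ P ++ (l ++ u ++ rr) ++ Q ∈ ϑ.imageWord z ∧
      j ≤ (P.length + N) % L := by
    obtain ⟨z, hz, _, hV, P, Q, rfl⟩ := hlur.exists_root h hL hL2
    by_cases hge : j ≤ (P.length + N) % L
    · exact ⟨z, P, Q, hz, hV, hge⟩
    · obtain ⟨z', p, q, hz', hV', e⟩ := hs z _ hz hV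
      refine ⟨z', p ++ P, Q ++ q, hz', by simpa using hV', ?_⟩
      rw [List.length_append, add_assoc, Nat.add_mod, e, Nat.mod_eq_of_lt hjL,
        Nat.mod_eq_of_lt (by omega)]
      omega
  -- Displacing by `j` changes the offset of `u` modulo `L`, so `u` lies inside a single inflation
  -- word.
  have hfit : (P.length + N) % L + u.length ≤ L := by
    obtain ⟨z', p, q, hz', hV', e⟩ := hs z _ hz hV
    refine (uncut_of_recognisable hL hu hrec hz hz' hl hrr hV (P' := p ++ P) (Q' := Q ++ q)
      (by simpa using hV') ?_).1
    rw [List.length_append, add_assoc, Nat.add_mod p.length, e, Nat.mod_eq_of_lt hjL]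
    have hlt := Nat.mod_lt (P.length + N) (show 0 < L by omega)
    generalize (P.length + N) % L = ρ at hlt
    intro heq
    by_cases hlt' : j + ρ < L
    · rw [Nat.mod_eq_of_lt hlt'] at heq; omega
    · rw [Nat.mod_eq_sub_mod (a := j + ρ) (by omega), Nat.mod_eq_of_lt (by omega)] at heq; omega
  have hdm := Nat.mod_add_div (P.length + N) L
  obtain ⟨z₁, v, z₂, p, w, q, rfl, hz₁, e, hp, hp', hw, hq⟩ :=
    exists_block hL hV (k := (P.length + N) / L)
      (by simp only [List.length_append]; omega)
  obtain ⟨a, d, hwa, hpa⟩ := exists_eq_append_of_aligned (X := P ++ l) (u := u) (Y := rr ++ Q)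
    (p := p) (w := w) (q := q) (by rw [← e]; simp)
    (by simp only [List.length_append]; omega)
    (by simp only [List.length_append, hL _ _ hw]; omega)
  have hal : j ≤ a.length := by
    have := congrArg List.length hpa
    simp only [List.length_append] at this; omega
  obtain ⟨w₁, c, rfl, hw₁⟩ : ∃ w₁ c, a = w₁ ++ c ∧ w₁.length = j :=
    ⟨_, _, (List.take_append_drop j a).symm, by simpa using hal⟩
  subst hwa
  have hpow : ∀ m, ∃ z p q, ϑ.Legal z ∧ p ++ (List.replicate m w₁).flatten ++
      (w₁ ++ c ++ u ++ d) ++ q ∈ ϑ.imageWord z ∧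
      L ∣ (p ++ (List.replicate m w₁).flatten).length := by
    intro m
    induction m with
    | zero =>
      refine ⟨_, p, q, hz, ?_, ?_⟩
      · rw [e] at hV; simpa using hV
      · simp [hp]
    | succ m ih =>
      obtain ⟨z, p, q, hz, hV, hd⟩ := ih
      obtain ⟨z', P, q', hz', hV', hd'⟩ := exists_move_right h hL hL2 hdisj hu hrec hj0 hjL hs'
        hw hw₁ hz hV hd
      refine ⟨z', P ++ p, q', hz', ?_, ?_⟩
      · rw [List.replicate_succ']; simpa using hV'
      · rw [List.replicate_succ']; simpa using hd'
  obtain ⟨R, hR⟩ := exists_length_forall_mem h hc hL hL2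
  -- Since `L = j * r`, the power groups into `R + 1` copies of one word `B` of length `L`; the root
  -- below them is long enough to contain every letter.
  obtain ⟨z, p, q, hz, hV, hd⟩ := hpow (r * (R + 1))
  rw [flatten_replicate_mul] at hV hd
  generalize hBe : (List.replicate r w₁).flatten = B at hV hd
  have hB : B.length = L := by rw [← hBe, hr]; simp [hw₁, mul_comm]
  have hBl : (List.replicate (R + 1) B).flatten.length = L * (R + 1) := by
    simp [hB, mul_comm]
  rw [List.length_append, hBl] at hd
  obtain ⟨k, hk⟩ := (Nat.dvd_add_left (dvd_mul_right L (R + 1))).1 hd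
  have hzl := length_of_mem_imageWord hL hV
  rw [List.length_append, List.length_append, List.length_append, hBl, hk] at hzl
  have hkz : k + (R + 1) ≤ z.length := by
    refine Nat.le_of_mul_le_mul_left ?_ (show 0 < L by omega)
    rw [mul_add]; omega
  rw [List.append_assoc, List.append_assoc] at hV
  obtain ⟨-, h2⟩ := mem_imageWord_split hL hV hk (by omega)
  obtain ⟨h3, -⟩ := mem_imageWord_split hL h2 hBl (by simp; omega)
  have hmem := mem_image_of_replicate hL hB h3 (by simp; omega)
  have hall := hR ((z.drop k).take (R + 1)) (hz.infix
    ((List.take_prefix _ _).isInfix.trans (List.drop_suffix _ _).isInfix)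
    (List.ne_nil_of_length_pos (by simp; omega))) (by simp; omega)
  obtain ⟨b, hb⟩ := exists_ne_letter hnd hL e₀
  exact hb (hdisj _ _ ⟨B, hmem _ (hall b), hmem _ (hall e₀)⟩)

end Synchronisation


/-! ### Occurrences of words in bi-infinite sequences -/

section Occurrences

variable {A : Type*} {x y : ℤ → A} {n : ℤ} {u v w : List A}

/-- The word `w` occurs in `x` at position `n`. -/
def Occurs (x : ℤ → A) (n : ℤ) (w : List A) : Prop :=
  ∀ k (hk : k < w.length), x (n + k) = w[k]

@[simp] theorem length_subword (x : ℤ → A) (n : ℤ) (k : ℕ) : (subword x n k).length = k := by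
  simp [subword]

theorem getElem_subword (x : ℤ → A) (n : ℤ) (k i : ℕ) (h : i < (subword x n k).length) :
    (subword x n k)[i] = x (n + i) := by
  simp [subword]

theorem Occurs.eq_subword (h : Occurs x n w) : subword x n w.length = w :=
  List.ext_getElem (by simp) fun i h1 h2 => by rw [getElem_subword, h i h2]

theorem subword_add (x : ℤ → A) (n : ℤ) (a b : ℕ) :
    subword x n (a + b) = subword x n a ++ subword x (n + a) b := by
  refine List.ext_getElem (by simp) fun i h1 h2 => ?_
  rw [getElem_subword, List.getElem_append]
  split
  · rw [getElem_subword]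
  · next h =>
    rw [length_subword, not_lt] at h
    rw [getElem_subword, length_subword]
    congr 1
    push_cast [h]
    ring

theorem subword_congr {k : ℕ} (h : ∀ j, n ≤ j → j < n + k → x j = y j) :
    subword x n k = subword y n k :=
  List.ext_getElem (by simp) fun i h1 h2 => by
    rw [length_subword] at h1
    rw [getElem_subword, getElem_subword, h _ (by omega) (by omega)]

theorem occurs_append :
    Occurs x n (u ++ v) ↔ Occurs x n u ∧ Occurs x (n + u.length) v := by
  constructor
  · refine fun h => ⟨fun k hk => ?_, fun k hk => ?_⟩
    · rw [h k (by simp; omega), List.getElem_append_left hk]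
    · have := h (u.length + k) (by simp; omega)
      rw [List.getElem_append_right (by omega)] at this
      simpa [add_assoc] using this
  · rintro ⟨h1, h2⟩ k hk
    rw [List.getElem_append]
    split
    · next h => exact h1 k h
    · next h =>
      rw [not_lt] at h
      rw [← h2 (k - u.length) (by simp at hk; omega)]
      congr 1
      push_cast [h]
      ring

theorem Occurs.congr (h : Occurs x n w) (hxy : ∀ j, n ≤ j → j < n + w.length → x j = y j) :
    Occurs y n w := fun k hk => by
  rw [← h k hk, hxy _ (by omega) (by omega)]

theorem Occurs.prefix (hu : Occurs x n u) (hv : Occurs x n v) (h : u.length ≤ v.length) :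
    u <+: v := by
  rw [← hu.eq_subword, ← hv.eq_subword, ← Nat.add_sub_cancel' h, subword_add]
  exact List.prefix_append _ _

theorem Occurs.eq (hu : Occurs x n u) (hv : Occurs x n v) (h : u.length = v.length) : u = v :=
  (hu.prefix hv h.le).eq_of_length h

theorem subword_infix {a b : ℤ} {k l : ℕ} (h1 : a ≤ b) (h2 : b + k ≤ a + l) :
    subword x b k <:+: subword x a l := by
  obtain ⟨c, rfl⟩ := Int.le.dest h1
  obtain ⟨d, rfl⟩ : ∃ d, l = c + k + d := ⟨l - (c + k), by omega⟩
  exact ⟨subword x a c, subword x (a + (c + k : ℕ)) d, by rw [subword_add, subword_add]⟩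

theorem occurs_translate (m : ℤ) : Occurs (fun i => x (i + m)) n w ↔ Occurs x (n + m) w := by
  simp only [Occurs, add_right_comm]

end Occurrences

/-! ### Exchange systems and the group action they define -/

/-- A marker word together with, for each index `i`, words of a common length labelled by `G i`,
such that the marker only occurs at the two ends of `marker ++ word i a ++ marker`. -/
structure ExchangeSystem (A : Type*) {ι : Type*} (G : ι → Type*) where
  marker : List A
  word : (Σ i, G i) → List A
  length : ι → ℕ
  length_word : ∀ τ, (word τ).length = length τ.1
  length_injective : Function.Injective length
  word_injective : Function.Injective word
  marker_eq : ∀ τ p q, marker ++ word τ ++ marker = p ++ marker ++ q → p = [] ∨ q = []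

namespace ExchangeSystem

variable {A : Type*} {ι : Type*} {G : ι → Type*} (E : ExchangeSystem A G)

/-- A labelled word between two markers. -/
def pattern (τ : Σ i, G i) : List A := E.marker ++ E.word τ ++ E.marker

theorem length_pattern (τ : Σ i, G i) :
    (E.pattern τ).length = E.marker.length + E.length τ.1 + E.marker.length := by
  simp [pattern, E.length_word, add_assoc]

theorem occurs_pattern {x : ℤ → A} {n : ℤ} {τ : Σ i, G i} :
    Occurs x n (E.pattern τ) ↔ Occurs x n E.marker ∧ Occurs x (n + E.marker.length) (E.word τ) ∧
      Occurs x (n + E.marker.length + E.length τ.1) E.marker := by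
  rw [pattern, occurs_append, occurs_append, and_assoc, List.length_append, E.length_word]
  push_cast
  rw [add_assoc n]

/-- The position `j` lies between the two markers of an occurrence of a pattern at `n`. -/
def Gap (x : ℤ → A) (n : ℤ) (τ : Σ i, G i) (j : ℤ) : Prop :=
  Occurs x n (E.pattern τ) ∧ n + E.marker.length ≤ j ∧ j < n + E.marker.length + E.length τ.1

variable {E} {x : ℤ → A} {n m j : ℤ} {τ τ' : Σ i, G i}

theorem marker_position (h : Occurs x n (E.pattern τ)) (hm : Occurs x m E.marker) (h1 : n ≤ m)
    (h2 : m ≤ n + E.marker.length + E.length τ.1) :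
    m = n ∨ m = n + E.marker.length + E.length τ.1 := by
  obtain ⟨k, rfl⟩ := Int.le.dest h1
  have hl := E.length_pattern τ
  have hk : ((E.pattern τ).take k).length = k := by simp; omega
  have h' := h
  rw [← List.take_append_drop k (E.pattern τ), occurs_append, hk] at h'
  obtain ⟨q, hq⟩ := hm.prefix h'.2 (by simp; omega)
  have e : E.pattern τ = (E.pattern τ).take k ++ E.marker ++ q := by
    rw [List.append_assoc, hq, List.take_append_drop]
  have hlen := congrArg List.length e
  rw [List.length_append, List.length_append, hk, hl] at hlen
  rcases E.marker_eq τ _ _ e with h0 | h0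
  · rw [h0] at hk
    left
    simp only [List.length_nil] at hk
    omega
  · rw [h0, List.length_nil] at hlen
    right
    omega

/-- Two patterns with overlapping gaps would otherwise have an end marker of one strictly inside the
other. Once both ends agree, the words coincide and determine the label. -/
theorem Gap.unique (h : E.Gap x n τ j) (h' : E.Gap x m τ' j) : n = m ∧ τ = τ' := by
  obtain ⟨ho, h1, h2⟩ := h
  obtain ⟨ho', h1', h2'⟩ := h'
  have hs := E.occurs_pattern.1 ho
  have hs' := E.occurs_pattern.1 ho'
  have hnm : n = m := by
    rcases lt_trichotomy n m with hlt | heq | hlt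
    · have := marker_position ho hs'.1 hlt.le (by omega); omega
    · exact heq
    · have := marker_position ho' hs.1 hlt.le (by omega); omega
  subst hnm
  refine ⟨rfl, E.word_injective (hs.2.1.eq hs'.2.1 ?_)⟩
  rw [E.length_word, E.length_word]
  rcases lt_trichotomy (E.length τ.1) (E.length τ'.1) with hlt | heq | hlt
  · have := marker_position ho' hs.2.2 (by omega) (by omega); omega
  · exact heq
  · have := marker_position ho hs'.2.2 (by omega) (by omega); omega

theorem not_gap_of_marker (hm : Occurs x m E.marker) (h1 : m ≤ j) (h2 : j < m + E.marker.length) :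
    ¬ E.Gap x n τ j := by
  rintro ⟨ho, h1', h2'⟩
  have := marker_position ho hm (by omega) (by omega)
  omega

theorem gap_translate : E.Gap (fun i => x (i + m)) n τ j ↔ E.Gap x (n + m) τ (j + m) := by
  rw [Gap, Gap, occurs_translate]
  refine and_congr Iff.rfl (and_congr ?_ ?_) <;> constructor <;> intro h <;> omega

variable [∀ i, Group (G i)]

/-- The action of `G` on the labels. -/
def act (g : ∀ i, G i) (τ : Σ i, G i) : Σ i, G i := ⟨τ.1, g τ.1 * τ.2⟩

@[simp] theorem act_fst (g : ∀ i, G i) (τ : Σ i, G i) : (act g τ).1 = τ.1 := rfl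

open Classical in
/-- Exchange the labelled words between consecutive markers according to `g`. -/
noncomputable def exchange (E : ExchangeSystem A G) (g : ∀ i, G i) (x : ℤ → A) (j : ℤ) : A :=
  if h : ∃ q : ℤ × Σ i, G i, E.Gap x q.1 q.2 j then
    (E.word (act g h.choose.2)).getD (j - (h.choose.1 + E.marker.length)).toNat (x j)
  else x j

variable {g h : ∀ i, G i}

/-- Uniqueness of gaps makes the choice in `exchange` immaterial; inside a gap the index is in
range, so the default of `getD` is never reached. -/
theorem exchange_of_gap (hg : E.Gap x n τ j) : E.exchange g x j =
    (E.word (act g τ)).getD (j - (n + E.marker.length)).toNat (x j) := by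
  have hex : ∃ q : ℤ × Σ i, G i, E.Gap x q.1 q.2 j := ⟨(n, τ), hg⟩
  obtain ⟨h1, h2⟩ := hg.unique hex.choose_spec
  rw [exchange, dif_pos hex, ← h1, ← h2]

theorem exchange_of_forall_not_gap (hg : ∀ n τ, ¬ E.Gap x n τ j) : E.exchange g x j = x j := by
  rw [exchange, dif_neg]
  rintro ⟨q, hq⟩
  exact hg _ _ hq

theorem Occurs.exchange_word (ho : Occurs x n (E.pattern τ)) :
    Occurs (E.exchange g x) (n + E.marker.length) (E.word (act g τ)) := by
  intro k hk
  have hk' : k < E.length τ.1 := by rw [E.length_word] at hk; exact hk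
  rw [exchange_of_gap ⟨ho, by omega, by omega⟩, List.getD_eq_getElem?_getD]
  have : (n + E.marker.length + k - (n + E.marker.length)).toNat = k := by omega
  rw [this, List.getElem?_eq_getElem hk, Option.getD_some]

theorem Occurs.exchange_marker (hm : Occurs x m E.marker) :
    Occurs (E.exchange g x) m E.marker :=
  hm.congr fun _ h1 h2 =>
    (exchange_of_forall_not_gap fun _ _ => not_gap_of_marker hm h1 h2).symm

theorem Occurs.exchange_pattern (ho : Occurs x n (E.pattern τ)) :
    Occurs (E.exchange g x) n (E.pattern (act g τ)) := by
  have hs := E.occurs_pattern.1 ho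
  exact E.occurs_pattern.2 ⟨Occurs.exchange_marker hs.1, Occurs.exchange_word ho,
    Occurs.exchange_marker hs.2.2⟩

theorem Gap.exchange (hg : E.Gap x n τ j) : E.Gap (E.exchange g x) n (act g τ) j :=
  ⟨Occurs.exchange_pattern hg.1, hg.2⟩

theorem Occurs.of_exchange_marker (hm : Occurs (E.exchange g x) m E.marker) :
    Occurs x m E.marker := by
  refine hm.congr fun j h1 h2 => exchange_of_forall_not_gap fun n τ hg => ?_
  exact not_gap_of_marker hm h1 h2 hg.exchange

/-- No new patterns appear. Either the gap meets an old one, whose exchanged pattern must then be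
the same by uniqueness, or nothing in it was altered and the pattern was already present. -/
theorem Gap.of_exchange (hg : E.Gap (E.exchange g x) n τ j) : ∃ n τ, E.Gap x n τ j := by
  obtain ⟨ho, h1, h2⟩ := hg
  by_cases hex : ∃ j' n' τ', n + E.marker.length ≤ j' ∧ j' < n + E.marker.length + E.length τ.1 ∧
      E.Gap x n' τ' j'
  · obtain ⟨j', n', τ', h1', h2', hg'⟩ := hex
    obtain ⟨rfl, rfl⟩ := (show E.Gap (E.exchange g x) n τ j' from ⟨ho, h1', h2'⟩).unique
      hg'.exchange
    exact ⟨n, τ', hg'.1, h1, h2⟩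
  · push Not at hex
    have hs := E.occurs_pattern.1 ho
    refine ⟨n, τ, E.occurs_pattern.2 ⟨Occurs.of_exchange_marker hs.1, hs.2.1.congr ?_,
      Occurs.of_exchange_marker hs.2.2⟩, h1, h2⟩
    intro j' h1' h2'
    rw [E.length_word] at h2'
    exact exchange_of_forall_not_gap fun n' τ' => hex j' n' τ' h1' h2'

theorem act_mul (τ : Σ i, G i) : act (g * h) τ = act g (act h τ) :=
  Sigma.ext rfl (heq_of_eq (mul_assoc _ _ _))

theorem act_of_eq_one (hg : g τ.1 = 1) : act g τ = τ := by
  simp [act, hg]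

theorem exchange_of_gap_of_eq_one (hg : E.Gap x n τ j) (h1 : g τ.1 = 1) :
    E.exchange g x j = x j := by
  have := Occurs.exchange_word (g := g) hg.1 (j - (n + E.marker.length)).toNat
  have ho := (E.occurs_pattern.1 hg.1).2.1 (j - (n + E.marker.length)).toNat
  obtain ⟨-, h2, h3⟩ := hg
  have e : n + E.marker.length + ((j - (n + E.marker.length)).toNat : ℤ) = j := by omega
  rw [e] at this ho
  rw [this (by rw [E.length_word, act_fst]; omega), ho (by rw [E.length_word]; omega)]
  simp only [act_of_eq_one h1]

theorem exchange_eq_self (hx : ¬ ∃ n τ, E.Gap x n τ j ∧ g τ.1 ≠ 1) :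
    E.exchange g x j = x j := by
  by_cases hex : ∃ n τ, E.Gap x n τ j
  · obtain ⟨n, τ, hg⟩ := hex
    refine exchange_of_gap_of_eq_one hg ?_
    by_contra hne
    exact hx ⟨n, τ, hg, hne⟩
  · push Not at hex
    exact exchange_of_forall_not_gap hex

theorem exchange_one (x : ℤ → A) : E.exchange 1 x = x := by
  funext j
  by_cases hex : ∃ n τ, E.Gap x n τ j
  · obtain ⟨n, τ, hg⟩ := hex
    exact exchange_of_gap_of_eq_one hg rfl
  · push Not at hex
    exact exchange_of_forall_not_gap hex

theorem exchange_mul (g h : ∀ i, G i) (x : ℤ → A) :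
    E.exchange (g * h) x = E.exchange g (E.exchange h x) := by
  funext j
  by_cases hex : ∃ n τ, E.Gap x n τ j
  · obtain ⟨n, τ, hg⟩ := hex
    have h1 := Occurs.exchange_word (g := g * h) hg.1 (j - (n + E.marker.length)).toNat
    have h2 := Occurs.exchange_word (g := g) (Occurs.exchange_pattern (g := h) hg.1)
      (j - (n + E.marker.length)).toNat
    obtain ⟨-, h3, h4⟩ := hg
    have e : n + E.marker.length + ((j - (n + E.marker.length)).toNat : ℤ) = j := by omega
    rw [e] at h1 h2
    rw [h1 (by rw [E.length_word, act_fst]; omega),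
      h2 (by rw [E.length_word, act_fst, act_fst]; omega)]
    simp only [act_mul]
  · have h1 : ∀ n τ, ¬ E.Gap (E.exchange h x) n τ j := fun n τ hg => hex hg.of_exchange
    push Not at hex
    rw [exchange_of_forall_not_gap hex, exchange_of_forall_not_gap h1,
      exchange_of_forall_not_gap hex]

theorem exchange_translate (g : ∀ i, G i) (x : ℤ → A) (m : ℤ) :
    E.exchange g (fun i => x (i + m)) = fun i => E.exchange g x (i + m) := by
  funext j
  by_cases hex : ∃ n τ, E.Gap (fun i => x (i + m)) n τ j
  · obtain ⟨n, τ, hg⟩ := hex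
    rw [exchange_of_gap hg, exchange_of_gap (gap_translate.1 hg)]
    congr 2
    omega
  · push Not at hex
    rw [exchange_of_forall_not_gap hex, exchange_of_forall_not_gap]
    intro n τ hg
    refine hex (n - m) τ (gap_translate.2 ?_)
    rwa [sub_add_cancel]

/-- If the words moved by `g` have length at most `C`, then `exchange g` is a sliding block code
with a window determined by `C`. -/
theorem exchange_congr {C : ℕ} (hC : ∀ i, g i ≠ 1 → E.length i ≤ C) {x y : ℤ → A} {j : ℤ}
    (hxy : ∀ k, j - (E.marker.length + C) ≤ k → k ≤ j + (E.marker.length + C) → x k = y k) :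
    E.exchange g x j = E.exchange g y j := by
  have transfer : ∀ {x y : ℤ → A}, (∀ k, j - (E.marker.length + C) ≤ k →
      k ≤ j + (E.marker.length + C) → x k = y k) → ∀ n τ, E.Gap x n τ j → g τ.1 ≠ 1 →
      E.Gap y n τ j := by
    intro x y hxy n τ ⟨ho, h1, h2⟩ hne
    have := hC _ hne
    refine ⟨ho.congr fun k hk1 hk2 => hxy k ?_ ?_, h1, h2⟩ <;>
    · rw [E.length_pattern] at hk2
      push_cast at hk2
      omega
  have hxyj := hxy j (by omega) (by omega)
  by_cases hex : ∃ n τ, E.Gap x n τ j ∧ g τ.1 ≠ 1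
  · obtain ⟨n, τ, hg, hne⟩ := hex
    rw [exchange_of_gap hg, exchange_of_gap (transfer hxy n τ hg hne), hxyj]
  · rw [exchange_eq_self hex, exchange_eq_self, hxyj]
    rintro ⟨n, τ, hg, hne⟩
    exact hex ⟨n, τ, transfer (fun k h1 h2 => (hxy k h1 h2).symm) n τ hg hne, hne⟩

end ExchangeSystem


/-! ### Points of the subshift and realisations -/

section Points

variable {A : Type*} {ϑ : RandomSubstitution A} {L : ℕ}

theorem mem_imageWord_subword_iff (hL : ∀ a, ∀ u ∈ ϑ.image a, u.length = L) {f : ℤ → A} {o : ℤ}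
    {z : List A} : subword f o (L * z.length) ∈ ϑ.imageWord z ↔
      ∀ i (hi : i < z.length), subword f (o + (L * i : ℕ)) L ∈ ϑ.image z[i] := by
  induction z generalizing o with
  | nil => simp [subword]
  | cons a z ih =>
    have e : L * (a :: z).length = L + L * z.length := by rw [List.length_cons]; ring
    rw [e, subword_add, mem_imageWord_cons]
    constructor
    · rintro ⟨s, hs, t, ht, e'⟩ i hi
      obtain ⟨rfl, rfl⟩ := List.append_inj e' (by rw [length_subword, hL _ _ hs])
      obtain _ | i := i
      · simpa using hs
      · have := ih.1 ht i (by simpa using hi)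
        rw [add_assoc] at this
        rw [mul_add, mul_one, add_comm (L * i)]
        push_cast at this ⊢
        exact this
    · intro h
      have h0 : subword f (o + (L * 0 : ℕ)) L ∈ ϑ.image a := h 0 (by simp)
      rw [mul_zero, Nat.cast_zero, add_zero] at h0
      refine ⟨_, h0, _, ih.2 fun i hi => ?_, rfl⟩
      have := h (i + 1) (by simpa using hi)
      rw [mul_add, mul_one, add_comm (L * i)] at this
      rw [add_assoc]
      push_cast at this ⊢
      exact this

/-- Every window of a point of the subshift extends to a realisation of a legal word. -/
theorem exists_realisation (h : ϑ.Primitive) (hL : ∀ a, ∀ u ∈ ϑ.image a, u.length = L)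
    (hL2 : 2 ≤ L) {x : ℤ → A} (hx : x ∈ ϑ.subshift) (a : ℤ) {n : ℕ} (hn : 1 ≤ n) :
    ∃ (z : List A) (f : ℤ → A) (o : ℤ), ϑ.Legal z ∧ subword f o (L * z.length) ∈ ϑ.imageWord z ∧
      o ≤ a ∧ a + n ≤ o + (L * z.length : ℕ) ∧ ∀ j, a ≤ j → j < a + n → f j = x j := by
  obtain ⟨z, hz, V, hV, p, q, e⟩ := (hx a n hn).exists_root h hL hL2
  have hlen := length_of_mem_imageWord hL hV
  have hlen' := congrArg List.length e
  simp only [List.length_append, length_subword] at hlen'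
  obtain ⟨f, hf⟩ : ∃ f, Occurs f (a - p.length) V := by
    refine ⟨fun j => V.getD (j - (a - p.length)).toNat (x j), fun k hk => ?_⟩
    have : (a - p.length + k - (a - p.length)).toNat = k := by omega
    simp only [this, List.getD_eq_getElem?_getD, List.getElem?_eq_getElem hk, Option.getD_some]
  refine ⟨z, f, a - p.length, hz, ?_, by omega, by omega, ?_⟩
  · rw [← hlen, hf.eq_subword]; exact hV
  · intro j h1 h2
    rw [← e, occurs_append, occurs_append] at hf
    have h3 := hf.1.2 (j - a).toNat (by rw [length_subword]; omega)
    rw [getElem_subword] at h3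
    have e1 : a - p.length + p.length + ((j - a).toNat : ℤ) = j := by omega
    have e2 : a + ((j - a).toNat : ℤ) = j := by omega
    rw [e1, e2] at h3
    exact h3

/-- Every legal word occurs in a point of the subshift. -/
theorem Legal.exists_mem_subshift (h : ϑ.Primitive) (hL : ∀ a, ∀ u ∈ ϑ.image a, u.length = L)
    (hL2 : 2 ≤ L) {w : List A} (hw : ϑ.Legal w) : ∃ x ∈ ϑ.subshift, Occurs x 0 w := by
  choose! p q hp hq hpq using fun (y : List A) (hy : ϑ.Legal y) => hy.exists_extend h hL hL2 1
  -- Each step adds one letter on either side, so `W n` is to occupy the positions from `-n` on, and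
  -- the limit point reads position `j` from `W j.natAbs`.
  let W : ℕ → List A := fun n => Nat.rec w (fun _ y => p y ++ y ++ q y) n
  have hW : ∀ n, W (n + 1) = p (W n) ++ W n ++ q (W n) := fun n => rfl
  have hleg : ∀ n, ϑ.Legal (W n) := by
    intro n
    induction n with
    | zero => exact hw
    | succ n ih => rw [hW]; exact hpq _ ih
  have hlen : ∀ n, (W n).length = w.length + 2 * n := by
    intro n
    induction n with
    | zero => rfl
    | succ n ih =>
      rw [hW, List.length_append, List.length_append, hp _ (hleg n), hq _ (hleg n), ih]
      ring
  have hw1 : 1 ≤ w.length := List.length_pos_of_ne_nil hw.1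
  have hstep : ∀ (d n k : ℕ), k < (W n).length → (W (n + d))[k + d]? = (W n)[k]? := by
    intro d n k hk
    induction d with
    | zero => rfl
    | succ d ih =>
      rw [← add_assoc, ← add_assoc, hW, List.append_assoc,
        List.getElem?_append_right (by rw [hp _ (hleg _)]; omega), hp _ (hleg _),
        Nat.add_sub_cancel, List.getElem?_append_left (by rw [hlen] at hk ⊢; omega), ih]
  obtain ⟨a, -⟩ := List.exists_mem_of_ne_nil w hw.1
  let x : ℤ → A := fun j => ((W j.natAbs)[(j + j.natAbs).toNat]?).getD a
  have hocc : ∀ n : ℕ, Occurs x (-n) (W n) := by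
    intro n k hk
    have key : (W (-(n : ℤ) + k).natAbs)[(-(n : ℤ) + k + (-(n : ℤ) + k).natAbs).toNat]? =
        (W n)[k]? := by
      generalize hm : (-(n : ℤ) + k).natAbs = m
      rcases le_total n m with hnm | hnm
      · obtain ⟨d, rfl⟩ := Nat.exists_eq_add_of_le hnm
        rw [← hstep d n k hk]
        congr 1
        push_cast
        omega
      · obtain ⟨d, rfl⟩ := Nat.exists_eq_add_of_le hnm
        obtain ⟨k, rfl⟩ : ∃ k', k = k' + d := ⟨k - d, by omega⟩
        rw [hstep d m k (by rw [hlen] at hk ⊢; omega)]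
        congr 1
        push_cast
        omega
    simp only [x, key, List.getElem?_eq_getElem hk, Option.getD_some]
  refine ⟨x, fun i n hn => ?_, hocc 0⟩
  have hinf : subword x i n <:+: W (i.natAbs + n) := by
    rw [← (hocc (i.natAbs + n)).eq_subword, hlen]
    exact subword_infix (by omega) (by omega)
  exact (hleg _).infix hinf (List.ne_nil_of_length_pos (by rw [length_subword]; omega))

end Points

/-! ### The action on the subshift -/

section Automorphisms

variable {A : Type*} {ϑ : RandomSubstitution A} {L : ℕ} {ι : Type*} {G : ι → Type*}
  {E : ExchangeSystem A G}

/-- The marker of `E` is a synchronising realisation of `t`, and the words labelled by `G i` are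
realisations of the word `b i`. -/
structure Realises (ϑ : RandomSubstitution A) (L : ℕ) (E : ExchangeSystem A G) (t : List A)
    (b : ι → List A) : Prop where
  marker_mem : E.marker ∈ ϑ.imageWord t
  word_mem : ∀ τ, E.word τ ∈ ϑ.imageWord (b τ.1)
  synchronising : ϑ.Synchronising L E.marker
  legal : ∀ i, ϑ.Legal (t ++ b i ++ t)

open ExchangeSystem in
theorem Realises.pattern_legal {t : List A} {b : ι → List A} (hE : ϑ.Realises L E t b)
    (hL : ∀ a, ∀ u ∈ ϑ.image a, u.length = L) (hL0 : 0 < L) (τ : Σ i, G i) :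
    ϑ.Legal (E.pattern τ) := by
  have h := append_mem_imageWord (append_mem_imageWord hE.marker_mem (hE.word_mem τ)) hE.marker_mem
  refine (hE.legal τ.1).imageWord h (List.ne_nil_of_length_pos ?_)
  rw [pattern, length_of_mem_imageWord hL h]
  exact Nat.mul_pos hL0 (List.length_pos_of_ne_nil (hE.legal τ.1).1)

variable [∀ i, Group (G i)]

open ExchangeSystem in
-- A window of `x` sits in a realisation of a legal root `z`. Exchanging patterns replaces whole
-- inflation words by others of the same type, so the outcome still realises `z`.
theorem Realises.exchange_mem_subshift {t : List A} {b : ι → List A} (hE : ϑ.Realises L E t b)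
    (h : ϑ.Primitive) (hL : ∀ a, ∀ u ∈ ϑ.image a, u.length = L)
    (hL2 : 2 ≤ L) (hdisj : ϑ.DisjointImagesOfLetters) {g : ∀ i, G i} {C : ℕ}
    (hC : ∀ i, g i ≠ 1 → E.length i ≤ C) {x : ℤ → A} (hx : x ∈ ϑ.subshift) :
    E.exchange g x ∈ ϑ.subshift := by
  classical
  intro c m hm
  -- A margin of `E.marker.length + C` on each side captures the whole pattern around any moved
  -- position of the target window.
  obtain ⟨a, ha⟩ : ∃ a : ℤ, a = c - (E.marker.length + C : ℕ) := ⟨_, rfl⟩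
  obtain ⟨n', hn'⟩ : ∃ n' : ℕ, n' = m + 2 * (E.marker.length + C) := ⟨_, rfl⟩
  obtain ⟨z, f, o, hz, hf, hoa, hao, hfx⟩ := exists_realisation h hL hL2 hx a (n := n') (by omega)
  -- Only patterns wholly inside the window are exchanged, because `f` is known to agree with `x`
  -- only there.
  let B : ℤ → Prop := fun j => ∃ n τ, E.Gap x n τ j ∧ a ≤ n ∧ n + (E.pattern τ).length ≤ a + n'
  let f' : ℤ → A := fun j => if B j then E.exchange g x j else f j
  have hf' : subword f' o (L * z.length) ∈ ϑ.imageWord z := by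
    rw [mem_imageWord_subword_iff hL] at hf ⊢
    intro i hi
    by_cases hB : ∃ j, o + (L * i : ℕ) ≤ j ∧ j < o + (L * i : ℕ) + L ∧ B j
    · obtain ⟨j, hj1, hj2, n, τ, ⟨ho, hn1, hn2⟩, hw1, hw2⟩ := hB
      have hfo : Occurs f n (E.pattern τ) := ho.congr fun k h1 h2 =>
        (hfx k (by omega) (by omega)).symm
      have ht := length_of_mem_imageWord hL hE.marker_mem
      have hb : E.length τ.1 = L * (b τ.1).length := by
        rw [← E.length_word, length_of_mem_imageWord hL (hE.word_mem τ)]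
      have hpl := E.length_pattern τ
      obtain ⟨k, rfl⟩ := Int.le.dest (hoa.trans hw1)
      have hd : L ∣ k := by
        obtain ⟨d, hd⟩ : ∃ d, L * z.length = k + E.marker.length + d :=
          ⟨L * z.length - (k + E.marker.length), by omega⟩
        have := hE.synchronising z (subword f o k) (subword f (o + (k + E.marker.length : ℕ)) d) hz
          (by
            have h1 := (mem_imageWord_subword_iff hL).2 hf
            have h2 := (E.occurs_pattern.1 hfo).1.eq_subword
            rwa [hd, subword_add, subword_add, h2] at h1)
        rwa [length_subword] at this
      obtain ⟨k, rfl⟩ := hd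
      have hi1 : k + t.length ≤ i := by
        have : L * (k + t.length) < L * (i + 1) := by
          rw [mul_add, mul_add, mul_one]; push_cast at hn1 hj2; omega
        have := Nat.lt_of_mul_lt_mul_left this
        omega
      obtain ⟨i, rfl⟩ := Nat.exists_eq_add_of_le hi1
      have hi2 : i < (b τ.1).length := by
        have : L * (k + t.length + i) < L * (k + t.length + (b τ.1).length) := by
          rw [mul_add, mul_add, mul_add (a := L) (c := (b τ.1).length), mul_add]
          rw [mul_add, mul_add] at hj1; omega
        have := Nat.lt_of_mul_lt_mul_left this
        omega
      have hile : L * i + L ≤ L * (b τ.1).length := by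
        rw [← Nat.mul_succ]; exact Nat.mul_le_mul_left L hi2
      have hpos : o + (L * (k + t.length + i) : ℕ) =
          o + (L * k : ℕ) + E.marker.length + (L * i : ℕ) := by
        rw [ht]; push_cast; ring
      have hwi : ∀ {y : ℤ → A} {τ' : Σ i, G i}, τ'.1 = τ.1 →
          Occurs y (o + (L * k : ℕ) + E.marker.length) (E.word τ') →
          subword y (o + (L * (k + t.length + i) : ℕ)) L ∈ ϑ.image (b τ.1)[i] := by
        intro y τ' hτ hy
        have h1 := hy.eq_subword
        have h2 := hE.word_mem τ'
        rw [← h1, E.length_word, hτ, hb] at h2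
        rw [hpos]
        exact (mem_imageWord_subword_iff hL).1 h2 i hi2
      -- The same block of `f` is an inflation word for both letters, so disjoint images identify
      -- them.
      have hzb : (b τ.1)[i] = z[k + t.length + i] := by
        refine hdisj _ _ ⟨_, hwi (τ' := τ) rfl (E.occurs_pattern.1 hfo).2.1, hf _ hi⟩
      rw [← hzb]
      have heq : subword f' (o + (L * (k + t.length + i) : ℕ)) L =
          subword (E.exchange g x) (o + (L * (k + t.length + i) : ℕ)) L := by
        refine subword_congr fun j' h1 h2 => if_pos ?_
        exact ⟨_, τ, ⟨ho, by omega, by omega⟩, hw1, hw2⟩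
      rw [heq]
      exact hwi (act_fst g τ) (Occurs.exchange_word ho)
    · have heq : subword f' (o + (L * i : ℕ)) L = subword f (o + (L * i : ℕ)) L := by
        refine subword_congr fun j h1 h2 => if_neg fun hj => hB ⟨j, h1, h2, hj⟩
      rw [heq]
      exact hf i hi
  have hagree : subword (E.exchange g x) c m = subword f' c m := by
    refine subword_congr fun j h1 h2 => ?_
    by_cases hB : B j
    · exact (if_pos hB).symm
    · have : f' j = f j := if_neg hB
      rw [this, hfx j (by omega) (by omega)]
      refine exchange_eq_self ?_
      rintro ⟨n, τ, hg, hne⟩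
      have hle := hC _ hne
      refine hB ⟨n, τ, hg, ?_⟩
      obtain ⟨-, h3, h4⟩ := hg
      rw [E.length_pattern]
      push_cast
      omega
  have hne : subword (E.exchange g x) c m ≠ [] :=
    List.ne_nil_of_length_pos (by rw [length_subword]; omega)
  rw [hagree] at hne ⊢
  have hinf : subword f' c m <:+: subword f' o (L * z.length) :=
    subword_infix (by omega) (by omega)
  refine (hz.imageWord hf' ?_).infix hinf hne
  rintro h0
  rw [h0, List.infix_nil] at hinf
  exact hne hinf

theorem exists_length_bound {g : ∀ i, G i} (hg : ∀ᶠ i in Filter.cofinite, g i = 1)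
    (E : ExchangeSystem A G) : ∃ C, ∀ i, g i ≠ 1 → E.length i ≤ C := by
  have hfin : {i | ¬ g i = 1}.Finite := hg
  refine ⟨hfin.toFinset.sup E.length, fun i hi => ?_⟩
  exact Finset.le_sup (f := E.length) (hfin.mem_toFinset.2 hi)

variable [TopologicalSpace A] [DiscreteTopology A]

theorem ExchangeSystem.continuous_exchange {g : ∀ i, G i} {C : ℕ}
    (hC : ∀ i, g i ≠ 1 → E.length i ≤ C) : Continuous (E.exchange g) := by
  refine continuous_pi fun j => continuous_discrete_rng.2 fun a => ?_
  rw [isOpen_iff_mem_nhds]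
  rintro x rfl
  have hU : IsOpen (Set.pi (Set.Icc (j - (E.marker.length + C)) (j + (E.marker.length + C)))
      fun k => ({x k} : Set A)) :=
    isOpen_set_pi (Set.finite_Icc _ _) fun k _ => isOpen_discrete _
  refine Filter.mem_of_superset (hU.mem_nhds fun k _ => rfl) fun y hy => ?_
  exact ExchangeSystem.exchange_congr hC fun k h1 h2 => hy k ⟨h1, h2⟩

/-- Finite support supplies the length bound needed for continuity and invariance. For injectivity,
a point containing the pattern labelled by the identity of `G i` reveals `g i`. -/
theorem Realises.exists_injective_hom {t : List A} {b : ι → List A} (hE : ϑ.Realises L E t b)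
    (h : ϑ.Primitive) (hL : ∀ a, ∀ u ∈ ϑ.image a, u.length = L)
    (hL2 : 2 ≤ L) (hdisj : ϑ.DisjointImagesOfLetters) :
    ∃ f : GroupDirectSum G →* ϑ.Aut, Function.Injective f := by
  have hfin : ∀ g : GroupDirectSum G, ∀ᶠ i in Filter.cofinite, g i = 1 := fun g => by
    simpa using g.eventually
  have hmem : ∀ (g : GroupDirectSum G) (x : ϑ.subshift), E.exchange g x.1 ∈ ϑ.subshift := by
    intro g x
    obtain ⟨C, hC⟩ := exists_length_bound (hfin g) E
    exact hE.exchange_mem_subshift h hL hL2 hdisj hC x.2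
  have hcont : ∀ g : GroupDirectSum G,
      Continuous fun x : ϑ.subshift => (⟨E.exchange g x.1, hmem g x⟩ : ϑ.subshift) := by
    intro g
    obtain ⟨C, hC⟩ := exists_length_bound (hfin g) E
    exact ((ExchangeSystem.continuous_exchange hC).comp continuous_subtype_val).subtype_mk _
  have hmul : ∀ (g g' : GroupDirectSum G) (x : ℤ → A),
      E.exchange g (E.exchange g' x) = E.exchange (g * g' : GroupDirectSum G) x := fun g g' x =>
    (ExchangeSystem.exchange_mul (g : ∀ i, G i) g' x).symm
  have hone : ∀ x : ℤ → A, E.exchange (1 : GroupDirectSum G) x = x :=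
    ExchangeSystem.exchange_one
  let Φ : GroupDirectSum G → ϑ.subshift ≃ₜ ϑ.subshift := fun g =>
    { toFun := fun x => ⟨E.exchange g x.1, hmem g x⟩
      invFun := fun x => ⟨E.exchange (g⁻¹ : GroupDirectSum G) x.1, hmem g⁻¹ x⟩
      left_inv := fun x => Subtype.ext (by simp only [hmul, inv_mul_cancel, hone])
      right_inv := fun x => Subtype.ext (by simp only [hmul, mul_inv_cancel, hone])
      continuous_toFun := hcont g
      continuous_invFun := hcont g⁻¹ }
  have hΦ : ∀ g, Φ g ∈ ϑ.Aut := by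
    intro g
    rw [Subgroup.mem_centralizer_iff]
    rintro _ rfl
    refine Homeomorph.ext fun x => Subtype.ext ?_
    exact (ExchangeSystem.exchange_translate (E := E) (g : ∀ i, G i) x.1 1).symm
  refine ⟨⟨⟨fun g => ⟨Φ g, hΦ g⟩, ?_⟩, ?_⟩, ?_⟩
  · exact Subtype.ext (Homeomorph.ext fun x => Subtype.ext (hone x.1))
  · intro g g'
    exact Subtype.ext (Homeomorph.ext fun x => Subtype.ext (hmul g g' x.1).symm)
  · rw [injective_iff_map_eq_one]
    intro g hg
    ext i
    have hfix : ∀ x ∈ ϑ.subshift, E.exchange g x = x := fun x hx =>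
      congrArg Subtype.val (DFunLike.congr_fun (congrArg Subtype.val hg) (⟨x, hx⟩ : ϑ.subshift))
    obtain ⟨x, hx, ho⟩ := (hE.pattern_legal hL (by omega) ⟨i, 1⟩).exists_mem_subshift h hL hL2
    have h1 := ExchangeSystem.Occurs.exchange_word (g := g) ho
    rw [hfix x hx] at h1
    have h2 := E.word_injective (h1.eq (E.occurs_pattern.1 ho).2.1 (by
      rw [E.length_word, E.length_word]; rfl))
    simpa [ExchangeSystem.act] using h2

end Automorphisms


/-! ### Non-overlap of the marker -/

/-- Combinatorics of the marker: `S` is a word of length `k₀ + k₁ + 1` whose last letter `β` does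
not occur among the `k₁` letters before it, and `D` is a word of length `n` with `β` in every window
of length `K`. Then `S` occurs in `S D S` only at the two ends. -/
theorem not_occurs_inside {T : Type*} {S D V : ℕ → T} {β : T} {k k₀ k₁ n K m : ℕ}
    (hk : k = k₀ + k₁ + 1) (hV₁ : ∀ i < k, V i = S i) (hV₂ : ∀ i < n, V (k + i) = D i)
    (hV₃ : ∀ i < k, V (k + n + i) = S i) (hS : ∀ i, k₀ ≤ i → i < k₀ + k₁ → S i ≠ β)
    (hSl : S (k₀ + k₁) = β) (hD : ∀ a, a + K ≤ n → ∃ i, a ≤ i ∧ i < a + K ∧ D i = β)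
    (hK : K + k₀ ≤ k₁) (hn : K ≤ n) (hocc : ∀ i < k, V (m + i) = S i) (hm : 0 < m) :
    ¬ m < k + n := by
  intro hm'
  -- Otherwise the final `β` of the first `S` would lie in the `β`-free stretch of the inner copy,
  -- so that stretch starts after the first `S`.
  have hm1 : k ≤ m + k₀ := by
    by_contra hlt
    have h1 := hocc (k₀ + k₁ - m) (by omega)
    rw [show m + (k₀ + k₁ - m) = k₀ + k₁ by omega, hV₁ _ (by omega), hSl] at h1
    exact hS _ (by omega) (by omega) h1.symm
  have hlast := hocc (k₀ + k₁) (by omega)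
  have hwin : ∀ i, i < n → m + k₀ ≤ k + i → k + i < m + k₀ + k₁ → D i ≠ β := by
    intro i hi h1 h2
    rw [← hV₂ i hi, show k + i = m + (k + i - m) by omega, hocc _ (by omega)]
    exact hS _ (by omega) (by omega)
  by_cases hc : m + k₀ + k₁ < k + n
  · obtain ⟨i, h1, h2, h3⟩ := hD (m + k₀ - k) (by omega)
    exact hwin i (by omega) (by omega) (by omega) h3
  -- Here the final `β` of the inner copy falls in the second `S`, necessarily among its first `k₀`
  -- letters. As `K + k₀ ≤ k₁`, the `β`-free stretch then covers the last `K` letters of `D`.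
  · have hm2 : m ≤ n + k₀ := by
      by_contra hlt
      rw [show m + (k₀ + k₁) = k + n + (m + k₀ + k₁ - k - n) by omega, hV₃ _ (by omega), hSl]
        at hlast
      exact hS _ (by omega) (by omega) hlast
    obtain ⟨i, h1, h2, h3⟩ := hD (n - K) (by omega)
    exact hwin i (by omega) (by omega) (by omega) h3

/-! ### Realisations as lists of inflation words -/

section Blocks

variable {A : Type*} {ϑ : RandomSubstitution A} {L : ℕ}

theorem length_flatten_of_forall {ls : List (List A)} (h : ∀ l ∈ ls, l.length = L) :
    ls.flatten.length = L * ls.length := by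
  induction ls with
  | nil => simp
  | cons l ls ih =>
    rw [List.flatten_cons, List.length_append, h l (by simp),
      ih fun l' hl' => h l' (by simp [hl']), List.length_cons]
    ring

theorem take_drop_flatten {ls : List (List A)} (h : ∀ l ∈ ls, l.length = L) {i : ℕ}
    (hi : i < ls.length) : (ls.flatten.drop (L * i)).take L = ls[i] := by
  induction ls generalizing i with
  | nil => simp at hi
  | cons l ls ih =>
    have hl : l.length = L := h l (by simp)
    obtain _ | i := i
    · simp [← hl]
    · rw [List.flatten_cons, mul_add, mul_one, add_comm, ← List.drop_drop, ← hl, List.drop_left, hl,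
        ih (fun l' hl' => h l' (by simp [hl'])) (by simpa using hi), List.getElem_cons_succ]

theorem getElem?_eq_of_flatten_eq {ls ls' : List (List A)} {p q : List A} {m : ℕ} (hL0 : 0 < L)
    (h : ∀ l ∈ ls, l.length = L) (h' : ∀ l ∈ ls', l.length = L)
    (e : ls.flatten = p ++ ls'.flatten ++ q) (hp : p.length = L * m) {i : ℕ}
    (hi : i < ls'.length) : ls[m + i]? = ls'[i]? := by
  have hlen := congrArg List.length e
  rw [List.length_append, List.length_append, length_flatten_of_forall h,
    length_flatten_of_forall h', hp] at hlen
  have hle : L * (i + 1) ≤ L * ls'.length := Nat.mul_le_mul_left L hi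
  have hmi : m + i < ls.length := by
    refine Nat.lt_of_mul_lt_mul_left (a := L) ?_
    rw [mul_add] at hle ⊢
    omega
  rw [List.getElem?_eq_getElem hmi, List.getElem?_eq_getElem hi, ← take_drop_flatten h hmi,
    ← take_drop_flatten h' hi, e, mul_add, ← List.drop_drop, ← hp, List.append_assoc,
    List.drop_left, List.drop_append_of_le_length, List.take_append_of_le_length]
  · rw [List.length_drop, length_flatten_of_forall h']
    rw [mul_add] at hle
    omega
  · rw [length_flatten_of_forall h']
    rw [mul_add] at hle
    omega

theorem flatten_mem_imageWord {ls : List (List A)} {z : List A}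
    (h : List.Forall₂ (fun w a => w ∈ ϑ.image a) ls z) : ls.flatten ∈ ϑ.imageWord z := by
  induction h with
  | nil => rfl
  | cons h _ ih => exact ⟨_, h, _, ih, rfl⟩

theorem exists_blocks {z V : List A} (h : V ∈ ϑ.imageWord z) :
    ∃ ls : List (List A), ls.flatten = V ∧ List.Forall₂ (fun w a => w ∈ ϑ.image a) ls z := by
  induction z generalizing V with
  | nil => exact ⟨[], h.symm, List.Forall₂.nil⟩
  | cons a z ih =>
    obtain ⟨s, hs, t, ht, rfl⟩ := h
    obtain ⟨ls, rfl, hls⟩ := ih ht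
    exact ⟨s :: ls, rfl, List.Forall₂.cons hs hls⟩

theorem forall_length_of_forall₂ (hL : ∀ a, ∀ u ∈ ϑ.image a, u.length = L) {ls : List (List A)}
    {z : List A} (h : List.Forall₂ (fun w a => w ∈ ϑ.image a) ls z) : ∀ l ∈ ls, l.length = L := by
  induction h with
  | nil => simp
  | cons h _ ih => exact List.forall_mem_cons.2 ⟨hL _ _ h, ih⟩

/-- The blocks of the realisation of `b` that uses `f` at position `q` and `g` elsewhere. -/
def switchBlocks (f g : A → List A) (b : List A) (q : ℕ) : List (List A) :=
  b.mapIdx fun i a => if i = q then f a else g a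

theorem forall₂_switchBlocks {f g : A → List A} (hf : ∀ a, f a ∈ ϑ.image a)
    (hg : ∀ a, g a ∈ ϑ.image a) (b : List A) (q : ℕ) :
    List.Forall₂ (fun w a => w ∈ ϑ.image a) (switchBlocks f g b q) b := by
  rw [List.forall₂_iff_get]
  refine ⟨by simp [switchBlocks], fun i h1 h2 => ?_⟩
  simp only [switchBlocks, List.get_eq_getElem, List.getElem_mapIdx]
  split
  · exact hf _
  · exact hg _

theorem getElem?_switchBlocks (f g : A → List A) (b : List A) (q i : ℕ) :
    (switchBlocks f g b q)[i]? = b[i]?.map fun a => if i = q then f a else g a := by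
  simp [switchBlocks, List.getElem?_mapIdx]

end Blocks

/-! ### Construction of the marker and the labelled words -/

section Construction

variable {A : Type*} {ϑ : RandomSubstitution A} {L : ℕ}

theorem exists_legal_le_count [DecidableEq A] (h : ϑ.Primitive)
    (hL : ∀ a, ∀ u ∈ ϑ.image a, u.length = L) (hL2 : 2 ≤ L) (e : A) (c : ℕ) :
    ∃ y, ϑ.Legal y ∧ c ≤ y.count e := by
  induction c with
  | zero => exact ⟨[e], legal_singleton e, Nat.zero_le _⟩
  | succ c ih =>
    obtain ⟨y, hy, hc⟩ := ih
    obtain ⟨m, hm⟩ := hy.exists_append h hL hL2 (legal_singleton e)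
    refine ⟨_, hm, ?_⟩
    rw [List.count_append, List.count_append, List.count_singleton_self]
    omega

theorem exists_positions [DecidableEq A] {H : Type*} [Finite H] {b : List A} {e : A}
    (h : Nat.card H ≤ b.count e) :
    ∃ pos : H → ℕ, Function.Injective pos ∧ ∀ a, b[pos a]? = some e := by
  have hsub : (List.replicate (Nat.card H) e).Sublist b := List.replicate_sublist_iff.2 h
  obtain ⟨f, hf⟩ := List.sublist_iff_exists_fin_orderEmbedding_get_eq.1 hsub
  let φ : H ≃ Fin (Nat.card H) := Finite.equivFin H
  refine ⟨fun a => f (Fin.cast (List.length_replicate).symm (φ a)), ?_, fun a => ?_⟩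
  · intro a a' haa
    exact φ.injective (Fin.cast_injective _ (f.injective (Fin.ext haa)))
  · have := hf (Fin.cast (List.length_replicate).symm (φ a))
    simp only [List.get_eq_getElem, List.getElem_replicate] at this
    rw [List.getElem?_eq_getElem (Fin.is_lt _), ← this]

/-- The gaps between consecutive occurrences of `e` in legal words being less than `R`, switching
a single position of `b` leaves the value `g e` in every window of length `2 * R`. -/
theorem exists_mem_window {e : A} {R : ℕ} (hR : ∀ w, ϑ.Legal w → R ≤ w.length → e ∈ w)
    (hR0 : 0 < R) {b : List A} (hb : ϑ.Legal b) (f g : A → List A) (q a : ℕ)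
    (ha : a + 2 * R ≤ b.length) :
    ∃ i, a ≤ i ∧ i < a + 2 * R ∧ (switchBlocks f g b q)[i]? = some (g e) := by
  have key : ∀ c, c + R ≤ b.length → ∃ i, c ≤ i ∧ i < c + R ∧ b[i]? = some e := by
    intro c hc
    have hlen : ((b.drop c).take R).length = R := by simp; omega
    have hmem := hR ((b.drop c).take R) (hb.infix
      ((List.take_prefix _ _).isInfix.trans (List.drop_suffix _ _).isInfix)
      (List.ne_nil_of_length_pos (by omega))) hlen.ge
    obtain ⟨i, hi, he⟩ := List.getElem_of_mem hmem
    rw [hlen] at hi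
    refine ⟨c + i, by omega, by omega, ?_⟩
    rw [List.getElem?_eq_getElem (by omega), ← he]
    simp
  -- The window has two halves of length `R`, and at least one avoids the switched position `q`.
  by_cases hq : a ≤ q ∧ q < a + R
  · obtain ⟨i, h1, h2, h3⟩ := key (a + R) (by omega)
    refine ⟨i, by omega, by omega, ?_⟩
    rw [getElem?_switchBlocks, h3, Option.map_some, if_neg (by omega)]
  · obtain ⟨i, h1, h2, h3⟩ := key a (by omega)
    refine ⟨i, by omega, by omega, ?_⟩
    rw [getElem?_switchBlocks, h3, Option.map_some, if_neg (by omega)]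

/-- The marker begins with a synchronising word, continues with a long run of blocks other than
`β'`, and ends in `β'`. Labelled words realise `e` by `β'` except at one position, where `β` stands;
they therefore contain `β'` too often to accommodate the run. -/
theorem exists_realises [DecidableEq A] (hnd : ¬ ϑ.Degenerate) (h : ϑ.Primitive)
    (hc : ϑ.Compatible) (hdisj : ϑ.DisjointImagesOfLetters) (hrec : ϑ.AdmitsRecognisableWord)
    (hL : ∀ a, ∀ u ∈ ϑ.image a, u.length = L) {ι : Type*} [Countable ι] (G : ι → Type*)
    [∀ i, Finite (G i)] :
    ∃ (E : ExchangeSystem A G) (t : List A) (b : ι → List A), ϑ.Realises L E t b := by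
  have hL2 := two_le_length hnd hc hL
  obtain ⟨t₀, w₀, ht₀, hw₀, hsync⟩ := exists_synchronising hnd h hc hdisj hrec hL
  obtain ⟨e, β, hβ, β', hβ', hne⟩ := exists_two_images hnd
  obtain ⟨R, hR0, hR⟩ : ∃ R, 0 < R ∧ ∀ w, ϑ.Legal w → R ≤ w.length → e ∈ w := by
    obtain ⟨R, hR⟩ := exists_length_forall_mem h hc hL hL2
    exact ⟨R + 1, by omega, fun w hw hl => hR w hw (by omega) e⟩
  -- This length bound is the condition `K + k₀ ≤ k₁` of `not_occurs_inside`, with `K = 2 * R`.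
  obtain ⟨t₁, ht₁, hlt₁⟩ : ∃ t₁, ϑ.Legal (t₀ ++ t₁ ++ [e]) ∧ 2 * R + t₀.length ≤ t₁.length := by
    obtain ⟨y, hy, hyc⟩ := exists_legal_le_count h hL hL2 e (2 * R + t₀.length)
    obtain ⟨m, hm⟩ := ht₀.exists_append h hL hL2 hy
    obtain ⟨m', hm'⟩ := hm.exists_append h hL hL2 (legal_singleton e)
    refine ⟨m ++ y ++ m', by simpa using hm', ?_⟩
    have := List.count_le_length (a := e) (l := y)
    simp only [List.length_append]
    omega
  choose r hr using ϑ.image_nonempty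
  obtain ⟨base, hbase⟩ : ∃ f, f = Function.update r e β := ⟨_, rfl⟩
  obtain ⟨alt, halt⟩ : ∃ f, f = Function.update r e β' := ⟨_, rfl⟩
  have hbase_e : base e = β := by simp [hbase]
  have halt_e : alt e = β' := by simp [halt]
  have hbase_mem : ∀ a, base a ∈ ϑ.image a := by
    intro a
    by_cases ha : a = e
    · rw [ha, hbase_e]; exact hβ
    · rw [hbase, Function.update_of_ne ha]; exact hr a
  have halt_mem : ∀ a, alt a ∈ ϑ.image a := by
    intro a
    by_cases ha : a = e
    · rw [ha, halt_e]; exact hβ'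
    · rw [halt, Function.update_of_ne ha]; exact hr a
  have hbase_ne : ∀ a, base a ≠ β' := by
    intro a ha
    by_cases hae : a = e
    · rw [hae, hbase_e] at ha; exact hne ha
    · exact hae (hdisj _ _ ⟨β', ha ▸ hbase_mem a, hβ'⟩)
  obtain ⟨B₀, rfl, hB₀⟩ := exists_blocks hw₀
  have hB₀l := hB₀.length_eq
  obtain ⟨B, hB⟩ : ∃ B, B = B₀ ++ t₁.map base ++ [β'] := ⟨_, rfl⟩
  obtain ⟨t, ht⟩ : ∃ t, t = t₀ ++ t₁ ++ [e] := ⟨_, rfl⟩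
  have hBt : List.Forall₂ (fun w a => w ∈ ϑ.image a) B t := by
    rw [hB, ht]
    refine List.rel_append (List.rel_append hB₀ ?_) (List.Forall₂.cons hβ' List.Forall₂.nil)
    rw [List.forall₂_map_left_iff, List.forall₂_same]
    exact fun a _ => hbase_mem a
  have htl : ϑ.Legal t := ht ▸ ht₁
  have hsyncB : ϑ.Synchronising L B.flatten :=
    hsync.infix (a := []) (k := 0) (b := (t₁.map base ++ [β']).flatten) (by simp [hB]) (by simp)
  obtain ⟨enc, henc⟩ := exists_injective_nat ι
  have hfreq : ∀ k : ℕ, ∃ᶠ n in Filter.atTop, ∀ i, enc i = k →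
      ∃ (b : List A) (pos : G i → ℕ), b.length = n ∧ 2 * R ≤ n ∧ ϑ.Legal (t ++ b ++ t) ∧
        Function.Injective pos ∧ ∀ a, b[pos a]? = some e := by
    intro k
    rw [Filter.frequently_atTop]
    intro N
    by_cases hk : ∃ i, enc i = k
    · obtain ⟨i, rfl⟩ := hk
      obtain ⟨y, hy, hyc⟩ := exists_legal_le_count h hL hL2 e (N + 2 * R + Nat.card (G i))
      obtain ⟨m, hm⟩ := htl.exists_append h hL hL2 hy
      obtain ⟨m', hm'⟩ := hm.exists_append h hL hL2 htl
      have hcount : N + 2 * R + Nat.card (G i) ≤ (m ++ y ++ m').count e := by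
        simp only [List.count_append]; omega
      have hle := hcount.trans List.count_le_length
      refine ⟨(m ++ y ++ m').length, by omega, fun i' hi' => ?_⟩
      obtain rfl := henc hi'
      obtain ⟨pos, hpos, hpe⟩ := exists_positions (H := G i') (b := m ++ y ++ m') (e := e)
        (by omega)
      exact ⟨m ++ y ++ m', pos, rfl, by omega, by simpa using hm', hpos, hpe⟩
    · exact ⟨N, le_rfl, fun i hi => (hk ⟨i, hi⟩).elim⟩
  -- Admissible root lengths are unbounded for each index, so a strictly increasing choice gives
  -- different indices different lengths; this separates words of different indices.
  obtain ⟨φ, hφ, hP⟩ := Filter.extraction_forall_of_frequently hfreq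
  choose b pos hbl hb2 hleg hpos hpe using fun i => hP (enc i) i rfl
  have hbleg : ∀ i, ϑ.Legal (b i) := fun i => (hleg i).infix ⟨t, t, rfl⟩
    (List.ne_nil_of_length_pos (by have := hb2 i; rw [hbl]; omega))
  have hsw : ∀ i q, List.Forall₂ (fun w a => w ∈ ϑ.image a) (switchBlocks base alt (b i) q) (b i) :=
    fun i q => forall₂_switchBlocks hbase_mem halt_mem _ _
  have hswl : ∀ i q, (switchBlocks base alt (b i) q).flatten.length = L * φ (enc i) := by
    intro i q
    rw [length_of_mem_imageWord hL (flatten_mem_imageWord (hsw i q)), hbl]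
  refine ⟨{ marker := B.flatten
            word := fun τ => (switchBlocks base alt (b τ.1) (pos τ.1 τ.2)).flatten
            length := fun i => L * φ (enc i)
            length_word := fun τ => hswl _ _
            length_injective := ?_
            word_injective := ?_
            marker_eq := ?_ }, t, b, ?_⟩
  · intro i i' hii
    exact henc (hφ.injective (Nat.eq_of_mul_eq_mul_left (by omega) hii))
  · rintro ⟨i, a⟩ ⟨i', a'⟩ haa
    have hlen := congrArg List.length haa
    rw [hswl, hswl] at hlen
    obtain rfl := henc (hφ.injective (Nat.eq_of_mul_eq_mul_left (by omega) hlen))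
    have hpp : pos i a = pos i a' := by
      by_contra hpp
      have hlt : pos i a < (switchBlocks base alt (b i) (pos i a')).length := by
        rw [(hsw i _).length_eq]
        exact (List.getElem?_eq_some_iff.1 (hpe i a)).1
      have := getElem?_eq_of_flatten_eq (m := 0) (p := []) (q := []) (by omega)
        (forall_length_of_forall₂ hL (hsw i (pos i a)))
        (forall_length_of_forall₂ hL (hsw i (pos i a'))) (by simpa using haa) (by simp) hlt
      rw [zero_add, getElem?_switchBlocks, getElem?_switchBlocks, hpe, Option.map_some,
        Option.map_some, if_pos rfl, if_neg hpp, hbase_e, halt_e] at this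
      exact hne (Option.some.inj this)
    rw [hpos i hpp]
  · rintro ⟨i, a⟩ p q hpq
    obtain ⟨D, hD⟩ : ∃ D, D = switchBlocks base alt (b i) (pos i a) := ⟨_, rfl⟩
    have hDb := hsw i (pos i a)
    change B.flatten ++ (switchBlocks base alt (b i) (pos i a)).flatten ++ B.flatten = _ at hpq
    rw [← hD] at hpq hDb
    have hV : List.Forall₂ (fun w a => w ∈ ϑ.image a) (B ++ D ++ B) (t ++ b i ++ t) :=
      List.rel_append (List.rel_append hBt hDb) hBt
    have hVf : (B ++ D ++ B).flatten = p ++ B.flatten ++ q := by simpa using hpq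
    -- Synchronisation forces the copy of the marker onto block boundaries, so the comparison can be
    -- made block by block, with inflation words as letters.
    obtain ⟨m, hm⟩ := hsyncB _ p q (hleg i) (hVf ▸ flatten_mem_imageWord hV)
    have hlen := congrArg List.length hpq
    have hBL := forall_length_of_forall₂ hL hBt
    have hDL := forall_length_of_forall₂ hL hDb
    simp only [List.length_append, length_flatten_of_forall hBL, length_flatten_of_forall hDL, hm]
      at hlen
    have hBl : B.length = t₀.length + t₁.length + 1 := by rw [hB, ← hB₀l]; simp [add_assoc]
    have hDl : D.length = φ (enc i) := by rw [hDb.length_eq, hbl]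
    by_cases hm0 : m = 0
    · left
      exact List.length_eq_zero_iff.1 (by rw [hm, hm0, mul_zero])
    right
    have hnot := not_occurs_inside (S := fun i => B[i]?) (D := fun i => D[i]?)
      (V := fun i => (B ++ D ++ B)[i]?) (β := some β') (K := 2 * R) (m := m) (n := D.length) hBl
      (fun i hi => by
        simp only [List.append_assoc]
        rw [List.getElem?_append_left hi])
      (fun i hi => by
        simp only [List.append_assoc]
        rw [List.getElem?_append_right (by omega), Nat.add_sub_cancel_left,
          List.getElem?_append_left hi])
      (fun i hi => by
        rw [List.getElem?_append_right (by simp), List.length_append, Nat.add_sub_cancel_left])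
      (fun i h1 h2 => by
        simp only [hB]
        rw [List.append_assoc, List.getElem?_append_right (by omega),
          List.getElem?_append_left (by simp; omega), List.getElem?_map]
        intro hcon
        obtain ⟨c, -, hcc⟩ := Option.map_eq_some_iff.1 hcon
        exact hbase_ne c hcc)
      (by
        simp only [hB]
        rw [List.getElem?_append_right (by simp; omega)]
        simp [hB₀l])
      (fun c hc => by
        have := exists_mem_window hR hR0 (hbleg i) base alt (pos i a) c
          (by rw [hbl, ← hDl]; exact hc)
        rwa [halt_e, ← hD] at this)
      hlt₁ (by rw [hDl]; exact hb2 i)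
      (fun i hi => getElem?_eq_of_flatten_eq (by omega) (forall_length_of_forall₂ hL hV) hBL hVf hm
        hi)
      (by omega)
    have h1 : L * (B.length + D.length) ≤ L * m := Nat.mul_le_mul_left L (not_lt.1 hnot)
    rw [mul_add] at h1
    exact List.length_eq_zero_iff.1 (by omega)
  · exact
      { marker_mem := flatten_mem_imageWord hBt
        word_mem := fun τ => flatten_mem_imageWord (hsw _ _)
        synchronising := hsyncB
        legal := hleg }

end Construction

end RandomSubstitution

theorem theorem5 {A : Type*} [Finite A] [DecidableEq A] [TopologicalSpace A] [DiscreteTopology A]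
    (ϑ : RandomSubstitution A) (hnd : ¬ ϑ.Degenerate) (hlen : ϑ.ConstantLength)
    (hprim : ϑ.Primitive) (hcomp : ϑ.Compatible) (hdisj : ϑ.DisjointImagesOfLetters)
    (hrec : ϑ.AdmitsRecognisableWord)
    {ι : Type*} [Countable ι] (G : ι → Type*) [∀ i, Group (G i)] [∀ i, Finite (G i)] :
    ∃ f : GroupDirectSum G →* ϑ.Aut, Function.Injective f := by
  obtain ⟨L, hL⟩ := hlen
  have hL2 := RandomSubstitution.two_le_length hnd hcomp hL
  obtain ⟨E, t, b, hE⟩ := RandomSubstitution.exists_realises hnd hprim hcomp hdisj hrec hL G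
  exact hE.exists_injective_hom hprim hL hL2 hdisj
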